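/- Let $f$ be a smooth function on $[0,\infty)$, positive on $(0,\infty)$, with $f(r)=r+O(r^3)$ as $r\to0$ and $f'(r)\ge 1$ for all $r\ge 0$, and let $\Phi$ be a smooth function on $\mathbb R$. With $r=\sqrt{x^2+y^2+z^2}$ let $$M=\{(t,x,y,z)\in\mathbb R^4 : t>f(r)\},\qquad \zeta=\frac{t^2}{2}-\int_0^r\frac{f(s)}{f'(s)}\,ds,\qquad g=e^{2\Phi(\zeta)}\left(-dt^2+dx^2+dy^2+dz^2\right),$$ let $\mathcal O=(0,0,0,0)$, let $u=-\nabla\zeta/|\nabla\zeta|_g$ (a unit future-directed timelike vector field on $M$), and let $H=\tfrac13\operatorname{div}u$. A comoving observer is an integral curve $\gamma:(0,b)\to M$ of $u$, parametrized by proper time $\tau$ normalized so that $\gamma(\tau)\to\mathcal O$ as $\tau\to0$. A generalized scale factor along $\gamma$ is a positive function $\mathfrak a$ on $(0,b)$ with $\mathfrak a'/\mathfrak a=H\circ\gamma$. The shear scalar is $2\sigma^2=\sum_{i,j=1}^3\left(g(\nabla_{e_i}u,e_j)-H\delta_{ij}\right)^2$, where $e_1,e_2,e_3$ is any orthonormal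 basis of $u^\perp$. Then the following hold. (1) For every $\varepsilon>0$, $2\sigma^2\to0$ at $\mathcal O$ within $M_\varepsilon=\{t>(1+\varepsilon)f(r)\}$. (2) Through every point of $M$ there passes a comoving observer, and each comoving observer runs along the trajectory $t=\mu f(r)$ for exactly one $\mu\in(1,\infty]$ (where $\mu=\infty$ means $r=0$). (3) Along each comoving observer $\gamma$ a generalized scale factor exists, and each generalized scale factor $\mathfrak a$ along $\gamma$ is twice differentiable, satisfies $\mathfrak a(\tau)\to0$ as $\tau\to0$, and, if $\gamma$ runs along $t=\mu f(r)$, $$\lim_{\tau\to0}3\,\frac{\mathfrak a''(\tau)}{\mathfrak a(\tau)}=6e^{-2\Phi(0)}\left[\Phi'(0)-\frac{f'''(0)\,(5\mu^2+1)}{6(\mu^2-1)^2}\right],$$ where for $\mu=\infty$ the fraction is read as $0$. (4) Suppose $\Phi'(0)>0$ and set $$\mu_{\rm crit}=\sqrt{\frac{12\Phi'(0)+5f'''(0)+\sqrt{144\,\Phi'(0)f'''(0)+25f'''(0)^2}}{12\,\Phi'(0)}}.$$ Then, for all sufficiently small $\tau>0$, $\mathfrak a''(\tau)>0$ along each comoving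 observer with $\mu>\mu_{\rm crit}$, and $\mathfrak a''(\tau)<0$ along each comoving observer with $1<\mu<\mu_{\rm crit}$. If moreover $f'''(0)=0$, then along every comoving observer $\mathfrak a''(\tau)>0$ for all sufficiently small $\tau>0$. -/

import Mathlib

open Set Filter Topology Asymptotics
open scoped ContDiff Matrix

noncomputable section

/-- Coordinate space `ℝ⁴` with coordinates `(t, x, y, z)` indexed by `0, 1, 2, 3`.
The origin `𝒪` is the point `0`. -/
abbrev R4 : Type := Fin 4 → ℝ

/-! ### Pseudo-Riemannian geometry in one global chart -/

/-- The coordinate partial derivative `∂ᵢ F`. -/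
def partialD (i : Fin 4) (F : R4 → ℝ) (p : R4) : ℝ :=
  fderiv ℝ F p (Pi.single i 1)

/-- `g(X, Y)` at the point `p`, the metric being given by its component matrix. -/
def metricInner (g : R4 → Matrix (Fin 4) (Fin 4) ℝ) (p : R4) (X Y : R4) : ℝ :=
  ∑ i, ∑ j, g p i j * X i * Y j

/-- The Christoffel symbol `Γᵏᵢⱼ = ½ gᵏˡ (∂ᵢ gⱼₗ + ∂ⱼ gᵢₗ - ∂ₗ gᵢⱼ)`. -/
def christoffel (g : R4 → Matrix (Fin 4) (Fin 4) ℝ) (k i j : Fin 4) (p : R4) : ℝ :=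
  (1 / 2) * ∑ l, (g p)⁻¹ k l *
    (partialD i (fun q => g q j l) p + partialD j (fun q => g q i l) p
      - partialD l (fun q => g q i j) p)

/-- The Levi-Civita covariant derivative `∇_X V` at `p` of the vector field `V` in the direction
of the tangent vector `X`. -/
def covDeriv (g : R4 → Matrix (Fin 4) (Fin 4) ℝ) (X : R4) (V : R4 → R4) (p : R4) : R4 :=
  fun k => ∑ i, X i * (partialD i (fun q => V q k) p + ∑ j, christoffel g k i j p * V p j)

/-- The divergence of a vector field, the trace of `X ↦ ∇_X V`. -/
def divergence (g : R4 → Matrix (Fin 4) (Fin 4) ℝ) (V : R4 → R4) (p : R4) : ℝ :=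
  ∑ k, covDeriv g (Pi.single k 1) V p k

/-- The gradient `∇F`, with components `gᵏʲ ∂ⱼ F`. -/
def gradient4 (g : R4 → Matrix (Fin 4) (Fin 4) ℝ) (F : R4 → ℝ) (p : R4) : R4 :=
  fun k => ∑ j, (g p)⁻¹ k j * partialD j F p

/-- The length `|X|_g = √|g(X, X)|`. -/
def metricLength (g : R4 → Matrix (Fin 4) (Fin 4) ℝ) (p : R4) (X : R4) : ℝ :=
  Real.sqrt |metricInner g p X X|

/-- The mean curvature `H = ⅓ div u`. -/
def meanCurv (g : R4 → Matrix (Fin 4) (Fin 4) ℝ) (u : R4 → R4) (p : R4) : ℝ :=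
  (1 / 3) * divergence g u p

/-- The second fundamental form `K(X, Y) = g(∇_X u, Y)`. -/
def secondFF (g : R4 → Matrix (Fin 4) (Fin 4) ℝ) (u : R4 → R4) (p : R4) (X Y : R4) : ℝ :=
  metricInner g p (covDeriv g X u p) Y

/-- `e` is a `g`-orthonormal basis of the rest space `u^⊥` at `p`. -/
def IsRestFrame (g : R4 → Matrix (Fin 4) (Fin 4) ℝ) (u : R4 → R4) (p : R4)
    (e : Fin 3 → R4) : Prop :=
  (∀ i, metricInner g p (e i) (u p) = 0) ∧
    ∀ i j, metricInner g p (e i) (e j) = if i = j then 1 else 0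

/-- The shear scalar `2σ² = ∑ᵢⱼ σ(eᵢ, eⱼ)²` with `σ(eᵢ, eⱼ) = K(eᵢ, eⱼ) - H δᵢⱼ`, computed in an
orthonormal frame `e` of `u^⊥`. -/
def shearSq (g : R4 → Matrix (Fin 4) (Fin 4) ℝ) (u : R4 → R4) (p : R4)
    (e : Fin 3 → R4) : ℝ :=
  ∑ i, ∑ j, (secondFF g u p (e i) (e j) - if i = j then meanCurv g u p else 0) ^ 2

/-! ### The spacetimes -/

/-- The radius `r = √(x² + y² + z²)`. -/
def radius (p : R4) : ℝ := Real.sqrt (p 1 ^ 2 + p 2 ^ 2 + p 3 ^ 2)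

/-- The derivative `f'` of a function on `[0, ∞)` (one-sided at `0`). -/
def halfDeriv (f : ℝ → ℝ) (r : ℝ) : ℝ := derivWithin f (Ici 0) r

/-- The number `f'''(0)` for a function on `[0, ∞)`. -/
def thirdDerivZero (f : ℝ → ℝ) : ℝ := iteratedDerivWithin 3 f (Ici 0) 0

/-- The manifold `M = {t > f(r)}`. -/
def spacetimeM (f : ℝ → ℝ) : Set R4 := {p | f (radius p) < p 0}

/-- The region `M_ε = {t > (1 + ε) f(r)}`. -/
def spacetimeMEps (f : ℝ → ℝ) (ε : ℝ) : Set R4 := {p | (1 + ε) * f (radius p) < p 0}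

/-- The function `ζ = t²/2 - ∫₀ʳ f(s)/f'(s) ds`. -/
def zeta (f : ℝ → ℝ) (p : R4) : ℝ :=
  p 0 ^ 2 / 2 - ∫ s in (0 : ℝ)..radius p, f s / halfDeriv f s

/-- The metric `g = e^{2Φ(ζ)} (-dt² + dx² + dy² + dz²)`. -/
def spacetimeG (f Φ : ℝ → ℝ) (p : R4) : Matrix (Fin 4) (Fin 4) ℝ :=
  Real.exp (2 * Φ (zeta f p)) • Matrix.diagonal ![-1, 1, 1, 1]

/-- The unit future directed timelike vector field `u = -∇ζ / |∇ζ|_g`. -/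
def fluidU (f Φ : ℝ → ℝ) (p : R4) : R4 :=
  -(metricLength (spacetimeG f Φ) p (gradient4 (spacetimeG f Φ) (zeta f) p))⁻¹ •
    gradient4 (spacetimeG f Φ) (zeta f) p

/-- `γ : (0, b) → M` is a comoving observer: an integral curve of the unit field `u` in `M`, so that
its parameter is proper time, which is normalized by `γ(τ) → 𝒪` as `τ → 0`. -/
def IsComovingObserver (f Φ : ℝ → ℝ) (b : ℝ) (γ : ℝ → R4) : Prop :=
  0 < b ∧ (∀ τ ∈ Ioo 0 b, γ τ ∈ spacetimeM f ∧ HasDerivAt γ (fluidU f Φ (γ τ)) τ) ∧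
    Tendsto γ (𝓝[>] 0) (𝓝 0)

/-- `γ : (0, b) → M` runs along `t = μ f(r)`; for `μ = ∞` this means along `r = 0`. -/
def FollowsTrajectory (f : ℝ → ℝ) (b : ℝ) (γ : ℝ → R4) : WithTop ℝ → Prop
  | ⊤ => ∀ τ ∈ Ioo 0 b, radius (γ τ) = 0
  | (μ : ℝ) => ∀ τ ∈ Ioo 0 b, γ τ 0 = μ * f (radius (γ τ))

/-- `a` is a generalized scale factor along `γ : (0, b) → M`: a positive function on `(0, b)` with
`a' / a = H`. -/
def IsScaleFactor (f Φ : ℝ → ℝ) (b : ℝ) (γ : ℝ → R4) (a : ℝ → ℝ) : Prop :=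
  ∀ τ ∈ Ioo 0 b, 0 < a τ ∧ DifferentiableAt ℝ a τ ∧
    deriv a τ / a τ = meanCurv (spacetimeG f Φ) (fluidU f Φ) (γ τ)

/-- The value `6 e^{-2Φ(0)} [Φ'(0) - f'''(0) (5μ² + 1) / (6 (μ² - 1)²)]`; for `μ = ∞` the second
term in the bracket is absent. -/
def accelLimit (f Φ : ℝ → ℝ) : WithTop ℝ → ℝ
  | ⊤ => 6 * Real.exp (-2 * Φ 0) * deriv Φ 0
  | (μ : ℝ) => 6 * Real.exp (-2 * Φ 0) *
      (deriv Φ 0 - thirdDerivZero f * (5 * μ ^ 2 + 1) / (6 * (μ ^ 2 - 1) ^ 2))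

/-- The threshold `μ_crit`. -/
def muCrit (f Φ : ℝ → ℝ) : ℝ :=
  Real.sqrt ((12 * deriv Φ 0 + 5 * thirdDerivZero f +
      Real.sqrt (144 * deriv Φ 0 * thirdDerivZero f + 25 * thirdDerivZero f ^ 2)) /
    (12 * deriv Φ 0))

end

/-!
The field `V = t ∂ₜ + h ∂ᵣ` with `h = f / f'` is minus the Minkowski gradient of `ζ`, so that
`u = e^{-Φ} V / |V|`. The metric is conformally flat and diagonal, and the mean curvature and the
shear of `u` come out explicitly in terms of `h`, `h / r` and `h'`. Since `f'(0) = 1` and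
`f''(0) = 0`, the field `V` is the position vector field up to terms of third order, and the
position vector field has no shear; within `M_ε` the length `|V|` is bounded below by a multiple of
`t`, which leaves a factor tending to `0` in the shear scalar.

Along an integral curve of `u` the direction of `(x, y, z)` and the quotient `t / f(r)` are
conserved, which gives the trajectories `t = μ f(r)`; reparametrizing them by proper time gives an
observer through every point. On such a trajectory `dτ = e^{N(r)} dr` and
`H = e^{-N(r)} (1 / r + M'(r))`, where `M` and `N` have explicit expansions to second order at
`r = 0`, and `3 a'' / a = 3 (H' + H²)` is read off from their coefficients. The limit, as a
function of `μ² - 1`, has the sign of a quadratic polynomial whose positive root is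
`μ_crit² - 1`.
-/

noncomputable section

/-! ### Calculus on the half-line -/

section HalfLine

variable {g g' : ℝ → ℝ} {ℓ r : ℝ}

theorem contDiffOn_halfDeriv {n : ℕ} (hg : ContDiffOn ℝ (n + 1) g (Ici 0)) :
    ContDiffOn ℝ n (halfDeriv g) (Ici 0) :=
  hg.derivWithin (uniqueDiffOn_Ici 0) le_rfl

theorem hasDerivWithinAt_halfDeriv (hg : DifferentiableOn ℝ g (Ici 0)) (hr : 0 ≤ r) :
    HasDerivWithinAt g (halfDeriv g r) (Ici 0) r :=
  (hg r hr).hasDerivWithinAt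

theorem hasDerivAt_halfDeriv (hg : DifferentiableOn ℝ g (Ici 0)) (hr : 0 < r) :
    HasDerivAt g (halfDeriv g r) r :=
  (hasDerivWithinAt_halfDeriv hg hr.le).hasDerivAt (Ici_mem_nhds hr)

theorem thirdDerivZero_eq (g : ℝ → ℝ) :
    thirdDerivZero g = halfDeriv (halfDeriv (halfDeriv g)) 0 := by
  simp only [thirdDerivZero, iteratedDerivWithin_succ, halfDeriv, iteratedDerivWithin_zero]
  rfl

theorem tendsto_id_nhdsGT_zero : Tendsto (fun r : ℝ => r) (𝓝[>] 0) (𝓝 0) :=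
  tendsto_nhdsWithin_of_tendsto_nhds tendsto_id

theorem tendsto_nhdsGT_zero_of_continuousOn (hg : ContinuousOn g (Ici 0)) :
    Tendsto g (𝓝[>] 0) (𝓝 (g 0)) :=
  (hg 0 self_mem_Ici).mono_left (nhdsWithin_mono _ Ioi_subset_Ici_self)

theorem tendsto_div_nhdsGT_zero (hg : HasDerivWithinAt g ℓ (Ici 0) 0) (h0 : g 0 = 0) :
    Tendsto (fun r => g r / r) (𝓝[>] 0) (𝓝 ℓ) := by
  have h := hasDerivWithinAt_iff_tendsto_slope.1 hg
  rw [Ici_sdiff_left] at h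
  exact h.congr fun r => by simp [slope_def_field, h0]

theorem tendsto_div_pow_succ_nhdsGT_zero (n : ℕ) (hg : ∀ r, 0 < r → HasDerivAt g (g' r) r)
    (h0 : Tendsto g (𝓝[>] 0) (𝓝 0))
    (hℓ : Tendsto (fun r => g' r / r ^ n) (𝓝[>] 0) (𝓝 ℓ)) :
    Tendsto (fun r => g r / r ^ (n + 1)) (𝓝[>] 0) (𝓝 (ℓ / (n + 1))) := by
  refine HasDerivAt.lhopital_zero_nhdsGT (f' := g') (g' := fun r => (n + 1) * r ^ n)
    (by filter_upwards [self_mem_nhdsWithin] with r hr using hg r hr)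
    (Eventually.of_forall fun r => by simpa using hasDerivAt_pow (n + 1) r) ?_ h0
    (by simpa using tendsto_id_nhdsGT_zero.pow (n + 1)) ?_
  · filter_upwards [self_mem_nhdsWithin] with r (hr : 0 < r)
    positivity
  · exact (hℓ.div_const _).congr fun r => by rw [div_div, mul_comm]

end HalfLine

/-! ### Radial profiles -/

/-- The standing assumptions on the function `f` whose graph `t = f(r)` bounds the spacetime; only
three derivatives enter. -/
structure IsProfile (f : ℝ → ℝ) : Prop where
  contDiffOn : ContDiffOn ℝ 3 f (Ici 0)
  isBigO : (fun r => f r - r) =O[𝓝[≥] (0 : ℝ)] fun r => r ^ 3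
  one_le_halfDeriv : ∀ r, 0 ≤ r → 1 ≤ halfDeriv f r

/-- The radial component `h = f / f'` of the field `V = t ∂ₜ + h ∂ᵣ`, which is minus the Minkowski
gradient of `ζ`. -/
def radialPart (f : ℝ → ℝ) (r : ℝ) : ℝ := f r / halfDeriv f r

/-- The derivative `h' = 1 - f f'' / f'²` of `h = f / f'`. -/
def radialPartDeriv (f : ℝ → ℝ) (r : ℝ) : ℝ :=
  1 - f r * halfDeriv (halfDeriv f) r / halfDeriv f r ^ 2

/-- The factor `k = h / r`, continuously extended to `r = 0`, so that `V = (t, k x, k y, k z)`. -/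
def radialFactor (f : ℝ → ℝ) (r : ℝ) : ℝ := if r = 0 then 1 else radialPart f r / r

/-- The coefficient `k' / r = (h' - k) / r²` of `x ⊗ x` in the Jacobian `k δ + (k' / r) x ⊗ x` of
the spatial field `k x`. Division by zero gives it the value `0` at `r = 0`. -/
def anisotropy (f : ℝ → ℝ) (r : ℝ) : ℝ := (radialPartDeriv f r - radialFactor f r) / r ^ 2

namespace IsProfile

variable {f : ℝ → ℝ} (hf : IsProfile f) {r : ℝ}
include hf

theorem contDiffOn_halfDeriv : ContDiffOn ℝ 2 (halfDeriv f) (Ici 0) :=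
  _root_.contDiffOn_halfDeriv (n := 2) hf.contDiffOn

theorem contDiffOn_halfDeriv_halfDeriv : ContDiffOn ℝ 1 (halfDeriv (halfDeriv f)) (Ici 0) :=
  _root_.contDiffOn_halfDeriv (n := 1) hf.contDiffOn_halfDeriv

theorem continuousOn_thirdDeriv :
    ContinuousOn (halfDeriv (halfDeriv (halfDeriv f))) (Ici 0) :=
  (_root_.contDiffOn_halfDeriv (n := 0) hf.contDiffOn_halfDeriv_halfDeriv).continuousOn

theorem hasDerivAt (hr : 0 < r) : HasDerivAt f (halfDeriv f r) r :=
  hasDerivAt_halfDeriv (hf.contDiffOn.differentiableOn (by simp)) hr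

theorem hasDerivAt_halfDeriv (hr : 0 < r) :
    HasDerivAt (halfDeriv f) (halfDeriv (halfDeriv f) r) r :=
  _root_.hasDerivAt_halfDeriv (hf.contDiffOn_halfDeriv.differentiableOn (by simp)) hr

theorem hasDerivAt_halfDeriv_halfDeriv (hr : 0 < r) :
    HasDerivAt (halfDeriv (halfDeriv f)) (halfDeriv (halfDeriv (halfDeriv f)) r) r :=
  _root_.hasDerivAt_halfDeriv (hf.contDiffOn_halfDeriv_halfDeriv.differentiableOn (by simp)) hr

theorem apply_zero : f 0 = 0 := by
  obtain ⟨C, hC⟩ := hf.isBigO.bound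
  simpa using hC.self_of_nhdsWithin (by simp : (0 : ℝ) ∈ Ici 0)

theorem tendsto_sub_id_div_pow {n : ℕ} (hn : n < 3) :
    Tendsto (fun r => (f r - r) / r ^ n) (𝓝[>] 0) (𝓝 0) :=
  ((hf.isBigO.mono (nhdsWithin_mono _ Ioi_subset_Ici_self)).trans_isLittleO
    ((isLittleO_pow_pow hn).mono nhdsWithin_le_nhds)).tendsto_div_nhds_zero

theorem tendsto_div_id : Tendsto (fun r => f r / r) (𝓝[>] 0) (𝓝 1) := by
  have h := (hf.tendsto_sub_id_div_pow (n := 1) (by norm_num)).add_const 1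
  rw [zero_add] at h
  refine h.congr' ?_
  filter_upwards [self_mem_nhdsWithin] with r (hr : 0 < r)
  field_simp
  ring

theorem halfDeriv_zero : halfDeriv f 0 = 1 :=
  tendsto_nhds_unique (tendsto_div_nhdsGT_zero (hasDerivWithinAt_halfDeriv
    (hf.contDiffOn.differentiableOn (by simp)) le_rfl) hf.apply_zero) hf.tendsto_div_id

theorem halfDeriv_halfDeriv_zero : halfDeriv (halfDeriv f) 0 = 0 := by
  have h1 : Tendsto (fun r => (halfDeriv f r - 1) / r ^ 1) (𝓝[>] 0)
      (𝓝 (halfDeriv (halfDeriv f) 0)) := by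
    simpa only [pow_one] using tendsto_div_nhdsGT_zero ((hasDerivWithinAt_halfDeriv
      (hf.contDiffOn_halfDeriv.differentiableOn (by simp)) le_rfl).sub_const 1)
      (by simp [hf.halfDeriv_zero])
  have h2 := tendsto_div_pow_succ_nhdsGT_zero (g := fun r => f r - r) 1
    (fun r hr => (hf.hasDerivAt hr).sub (hasDerivAt_id r))
    (by simpa using hf.tendsto_sub_id_div_pow (n := 0) (by norm_num)) h1
  have h := tendsto_nhds_unique h2 (hf.tendsto_sub_id_div_pow (n := 2) (by norm_num))
  norm_num at h
  exact h

theorem halfDeriv_pos (hr : 0 ≤ r) : 0 < halfDeriv f r :=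
  one_pos.trans_le (hf.one_le_halfDeriv r hr)

theorem self_le_apply (hr : 0 ≤ r) : r ≤ f r := by
  have hd : ∀ x ∈ interior (Ici (0 : ℝ)), HasDerivAt (fun r => f r - r) (halfDeriv f x - 1) x := by
    intro x hx
    rw [interior_Ici] at hx
    exact (hf.hasDerivAt hx).sub (hasDerivAt_id x)
  have hm : MonotoneOn (fun r => f r - r) (Ici 0) :=
    monotoneOn_of_deriv_nonneg (convex_Ici 0) (hf.contDiffOn.continuousOn.sub continuousOn_id)
      (fun x hx => (hd x hx).differentiableAt.differentiableWithinAt) fun x hx => by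
        rw [(hd x hx).deriv]
        exact sub_nonneg.2 (hf.one_le_halfDeriv x (interior_subset hx))
  simpa [hf.apply_zero] using hm self_mem_Ici hr hr

theorem nonneg (hr : 0 ≤ r) : 0 ≤ f r := hr.trans (hf.self_le_apply hr)

theorem pos (hr : 0 < r) : 0 < f r := hr.trans_le (hf.self_le_apply hr.le)

/-! ### Expansions at `r = 0` -/

theorem tendsto_zero : Tendsto f (𝓝[>] 0) (𝓝 0) := by
  simpa [hf.apply_zero] using tendsto_nhdsGT_zero_of_continuousOn hf.contDiffOn.continuousOn

theorem tendsto_halfDeriv : Tendsto (halfDeriv f) (𝓝[>] 0) (𝓝 1) := by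
  simpa [hf.halfDeriv_zero] using
    tendsto_nhdsGT_zero_of_continuousOn hf.contDiffOn_halfDeriv.continuousOn

theorem tendsto_halfDeriv_halfDeriv : Tendsto (halfDeriv (halfDeriv f)) (𝓝[>] 0) (𝓝 0) := by
  simpa [hf.halfDeriv_halfDeriv_zero] using
    tendsto_nhdsGT_zero_of_continuousOn hf.contDiffOn_halfDeriv_halfDeriv.continuousOn

theorem tendsto_thirdDeriv :
    Tendsto (halfDeriv (halfDeriv (halfDeriv f))) (𝓝[>] 0) (𝓝 (thirdDerivZero f)) := by
  rw [thirdDerivZero_eq]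
  exact tendsto_nhdsGT_zero_of_continuousOn hf.continuousOn_thirdDeriv

theorem tendsto_halfDeriv_halfDeriv_div :
    Tendsto (fun r => halfDeriv (halfDeriv f) r / r) (𝓝[>] 0) (𝓝 (thirdDerivZero f)) := by
  rw [thirdDerivZero_eq]
  exact tendsto_div_nhdsGT_zero (hasDerivWithinAt_halfDeriv
    (hf.contDiffOn_halfDeriv_halfDeriv.differentiableOn (by simp)) le_rfl)
    hf.halfDeriv_halfDeriv_zero

theorem tendsto_halfDeriv_mul_sub_div_pow_three :
    Tendsto (fun r => (halfDeriv f r * r - f r) / r ^ 3) (𝓝[>] 0)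
      (𝓝 (thirdDerivZero f / 3)) := by
  have h := tendsto_div_pow_succ_nhdsGT_zero (g := fun r => halfDeriv f r * r - f r)
    (g' := fun r => halfDeriv (halfDeriv f) r * r) 2
    (fun r hr => (((hf.hasDerivAt_halfDeriv hr).mul (hasDerivAt_id r)).sub
      (hf.hasDerivAt hr)).congr_deriv (by simp))
    (by simpa using (hf.tendsto_halfDeriv.mul tendsto_id_nhdsGT_zero).sub hf.tendsto_zero)
    (hf.tendsto_halfDeriv_halfDeriv_div.congr' <| by
      filter_upwards [self_mem_nhdsWithin] with r (hr : 0 < r)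
      field_simp)
  norm_num at h
  exact h

theorem tendsto_halfDeriv_sub_one_div_sq :
    Tendsto (fun r => (halfDeriv f r - 1) / r ^ 2) (𝓝[>] 0) (𝓝 (thirdDerivZero f / 2)) := by
  have h := tendsto_div_pow_succ_nhdsGT_zero 1
    (fun r hr => (hf.hasDerivAt_halfDeriv hr).sub_const 1)
    (by simpa using hf.tendsto_halfDeriv.sub_const 1)
    (by simpa only [pow_one] using hf.tendsto_halfDeriv_halfDeriv_div)
  norm_num at h
  exact h

theorem thirdDerivZero_nonneg : 0 ≤ thirdDerivZero f := by
  have h : 0 ≤ thirdDerivZero f / 2 := by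
    refine ge_of_tendsto hf.tendsto_halfDeriv_sub_one_div_sq ?_
    filter_upwards [self_mem_nhdsWithin] with r (hr : 0 < r)
    exact div_nonneg (sub_nonneg.2 (hf.one_le_halfDeriv r hr.le)) (by positivity)
  linarith

/-! ### The functions `h` and `k` -/

theorem radialPart_nonneg (hr : 0 ≤ r) : 0 ≤ radialPart f r :=
  div_nonneg (hf.nonneg hr) (hf.halfDeriv_pos hr).le

theorem radialPart_le (hr : 0 ≤ r) : radialPart f r ≤ f r :=
  div_le_self (hf.nonneg hr) (hf.one_le_halfDeriv r hr)

theorem radialPart_zero : radialPart f 0 = 0 := by simp [radialPart, hf.apply_zero]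

theorem continuousOn_radialPart : ContinuousOn (radialPart f) (Ici 0) :=
  hf.contDiffOn.continuousOn.div hf.contDiffOn_halfDeriv.continuousOn
    fun _ hr => (hf.halfDeriv_pos hr).ne'

theorem hasDerivAt_radialPart (hr : 0 < r) :
    HasDerivAt (radialPart f) (radialPartDeriv f r) r := by
  have hne := (hf.halfDeriv_pos hr.le).ne'
  refine ((hf.hasDerivAt hr).div (hf.hasDerivAt_halfDeriv hr) hne).congr_deriv ?_
  unfold radialPartDeriv
  field_simp

theorem radialFactor_mul_self (r : ℝ) : radialFactor f r * r = radialPart f r := by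
  unfold radialFactor
  split_ifs with h
  · simp [h, hf.radialPart_zero]
  · field_simp

theorem anisotropy_mul_sq (hr : 0 ≤ r) :
    anisotropy f r * r ^ 2 = radialPartDeriv f r - radialFactor f r := by
  unfold anisotropy
  rcases hr.eq_or_lt with rfl | h
  · simp [radialPartDeriv, radialFactor, hf.apply_zero]
  · field_simp

theorem hasDerivAt_radialFactor (hr : 0 < r) :
    HasDerivAt (radialFactor f) (anisotropy f r * r) r := by
  have hquot : HasDerivAt (fun s => radialPart f s / s) (anisotropy f r * r) r := by
    refine ((hf.hasDerivAt_radialPart hr).div (hasDerivAt_id r) hr.ne').congr_deriv ?_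
    simp only [anisotropy, radialFactor, if_neg hr.ne', id]
    field_simp
  refine hquot.congr_of_eventuallyEq ?_
  filter_upwards [lt_mem_nhds hr] with s hs
  simp [radialFactor, hs.ne']

theorem tendsto_radialFactor_sub_one_div :
    Tendsto (fun r => (radialFactor f r - 1) / r) (𝓝[>] 0) (𝓝 0) := by
  have h := (hf.tendsto_halfDeriv_mul_sub_div_pow_three.neg.mul tendsto_id_nhdsGT_zero).div
    hf.tendsto_halfDeriv one_ne_zero
  simp only [mul_zero, zero_div] at h
  refine h.congr' ?_
  filter_upwards [self_mem_nhdsWithin] with r (hr : 0 < r)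
  have := (hf.halfDeriv_pos hr.le).ne'
  simp only [radialFactor, radialPart, if_neg hr.ne', Pi.div_apply]
  field_simp
  ring

theorem tendsto_radialPartDeriv_sub_radialFactor_div :
    Tendsto (fun r => (radialPartDeriv f r - radialFactor f r) / r) (𝓝[>] 0) (𝓝 0) := by
  have h := ((hf.tendsto_div_id.mul hf.tendsto_halfDeriv_halfDeriv).div
    (hf.tendsto_halfDeriv.pow 2) (by norm_num)).neg.sub hf.tendsto_radialFactor_sub_one_div
  simp only [mul_zero, zero_div, neg_zero, sub_zero] at h
  refine h.congr' ?_
  filter_upwards [self_mem_nhdsWithin] with r (hr : 0 < r)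
  have := (hf.halfDeriv_pos hr.le).ne'
  simp only [radialPartDeriv, Pi.div_apply]
  field_simp
  ring

theorem isLittleO_radialFactor_sub_one :
    (fun r => radialFactor f r - 1) =o[𝓝[≥] 0] fun r => r := by
  rw [← Ioi_insert, isLittleO_insert (by simp [radialFactor])]
  refine (isLittleO_iff_tendsto' ?_).2 hf.tendsto_radialFactor_sub_one_div
  filter_upwards [self_mem_nhdsWithin] with r (hr : 0 < r) h0 using absurd h0 hr.ne'

theorem isLittleO_radialPartDeriv_sub_radialFactor :
    (fun r => radialPartDeriv f r - radialFactor f r) =o[𝓝[≥] 0] fun r => r := by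
  rw [← Ioi_insert, isLittleO_insert (by simp [radialFactor, radialPartDeriv, hf.apply_zero])]
  refine (isLittleO_iff_tendsto' ?_).2 hf.tendsto_radialPartDeriv_sub_radialFactor_div
  filter_upwards [self_mem_nhdsWithin] with r (hr : 0 < r) h0 using absurd h0 hr.ne'

theorem continuousOn_radialFactor : ContinuousOn (radialFactor f) (Ici 0) := by
  intro r hr
  rcases (mem_Ici.1 hr).eq_or_lt with rfl | h
  · have h0 := hf.isLittleO_radialFactor_sub_one.trans_tendsto
      (tendsto_nhdsWithin_of_tendsto_nhds tendsto_id)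
    have h1 : radialFactor f 0 = 1 := by simp [radialFactor]
    simpa [ContinuousWithinAt, h1] using h0.add_const 1
  · exact (hf.hasDerivAt_radialFactor h).continuousAt.continuousWithinAt

end IsProfile

/-! ### Conformally flat metrics -/

/-- The linear form on `ℝ⁴` with coefficient vector `v`. -/
def linearForm (v : R4) : R4 →L[ℝ] ℝ := ∑ i, v i • ContinuousLinearMap.proj i

theorem linearForm_apply (v X : R4) : linearForm v X = ∑ i, v i * X i := by
  simp [linearForm]

/-- `F` is differentiable at `p` with partial derivatives `v 0, …, v 3`. -/
def HasPartials (F : R4 → ℝ) (v p : R4) : Prop := HasFDerivAt F (linearForm v) p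

namespace HasPartials

variable {F G : R4 → ℝ} {v w p : R4}

theorem partialD_eq (hF : HasPartials F v p) (i : Fin 4) : partialD i F p = v i := by
  rw [partialD, hF.fderiv, linearForm_apply]
  simp [Pi.single_apply]

theorem add (hF : HasPartials F v p) (hG : HasPartials G w p) :
    HasPartials (fun q => F q + G q) (v + w) p := by
  refine (HasFDerivAt.add hF hG).congr_fderiv ?_
  ext X
  simp [linearForm_apply, add_mul, Finset.sum_add_distrib]

theorem sum {ι : Type*} [Fintype ι] {F : ι → R4 → ℝ} {v : ι → R4}
    (hF : ∀ i, HasPartials (F i) (v i) p) :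
    HasPartials (fun q => ∑ i, F i q) (fun j => ∑ i, v i j) p := by
  refine (HasFDerivAt.fun_sum fun i _ => hF i).congr_fderiv ?_
  ext X
  simp only [sum_apply, linearForm_apply, Finset.sum_mul]
  exact Finset.sum_comm

theorem mul (hF : HasPartials F v p) (hG : HasPartials G w p) :
    HasPartials (fun q => F q * G q) (F p • w + G p • v) p := by
  refine (HasFDerivAt.mul hF hG).congr_fderiv ?_
  ext X
  simp [linearForm_apply, add_mul, mul_assoc, Finset.sum_add_distrib, Finset.mul_sum]

theorem scomp {φ : ℝ → ℝ} {φ' : ℝ} (hφ : HasDerivAt φ φ' (F p)) (hF : HasPartials F v p) :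
    HasPartials (fun q => φ (F q)) (φ' • v) p := by
  refine (hφ.comp_hasFDerivAt p hF).congr_fderiv ?_
  ext X
  simp [linearForm_apply, mul_assoc, Finset.mul_sum]

theorem comp_curve {γ : ℝ → R4} {γ' : R4} {τ : ℝ} (hF : HasPartials F v (γ τ))
    (hγ : HasDerivAt γ γ' τ) : HasDerivAt (fun s => F (γ s)) (∑ i, v i * γ' i) τ :=
  (HasFDerivAt.comp_hasDerivAt τ hF hγ).congr_deriv (linearForm_apply v γ')

end HasPartials

theorem hasPartials_coord (p : R4) (i : Fin 4) :
    HasPartials (fun q => q i) (Pi.single i 1) p := by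
  refine (ContinuousLinearMap.proj (R := ℝ) (φ := fun _ : Fin 4 => ℝ) i).hasFDerivAt.congr_fderiv ?_
  ext X
  simp [linearForm_apply, Pi.single_apply]

theorem hasPartials_mul_of_continuousAt {F G : R4 → ℝ} {w p : R4} (hF : ContinuousAt F p)
    (hG : HasPartials G w p) (h0 : G p = 0) :
    HasPartials (fun q => F q * G q) (F p • w) p := by
  rw [HasPartials, hasFDerivAt_iff_isLittleO] at hG ⊢
  have hsplit : (fun q => F q * G q - F p * G p - linearForm (F p • w) (q - p)) =
      fun q => F q * (G q - G p - linearForm w (q - p)) + (F q - F p) * linearForm w (q - p) := by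
    funext q
    have : linearForm (F p • w) (q - p) = F p * linearForm w (q - p) := by
      simp [linearForm_apply, mul_assoc, Finset.mul_sum]
    rw [this, h0]
    ring
  rw [hsplit]
  refine IsLittleO.add ?_ ?_
  · simpa using (hF.isBigO_one ℝ).mul_isLittleO hG.norm_right
  · have hcont : (fun q => F q - F p) =o[𝓝 p] fun _ => (1 : ℝ) := by
      rw [isLittleO_one_iff]
      simpa using hF.sub_const (F p)
    simpa using hcont.mul_isBigO ((linearForm w).isBigO_sub _ _).norm_right

/-- The signs of the Minkowski metric. -/
def eta : Fin 4 → ℝ := ![-1, 1, 1, 1]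

theorem eta_mul_self (k : Fin 4) : eta k * eta k = 1 := by
  fin_cases k <;> simp [eta]

/-- The Minkowski product `-X⁰Y⁰ + X¹Y¹ + X²Y² + X³Y³`. -/
def minkowskiInner (X Y : R4) : ℝ := ∑ i, eta i * X i * Y i

theorem minkowskiInner_apply (X Y : R4) :
    minkowskiInner X Y = -(X 0 * Y 0) + X 1 * Y 1 + X 2 * Y 2 + X 3 * Y 3 := by
  simp [minkowskiInner, Fin.sum_univ_four, eta]

theorem minkowskiInner_smul_right (X Y : R4) (c : ℝ) :
    minkowskiInner X (c • Y) = c * minkowskiInner X Y := by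
  simp only [minkowskiInner, Pi.smul_apply, smul_eq_mul, Finset.mul_sum]
  exact Finset.sum_congr rfl fun i _ => by ring

/-- The conformally flat metric `e^{2φ} η`. -/
def conformalMetric (φ : R4 → ℝ) (p : R4) : Matrix (Fin 4) (Fin 4) ℝ :=
  Real.exp (2 * φ p) • Matrix.diagonal eta

theorem conformalMetric_inv (φ : R4 → ℝ) (p : R4) :
    (conformalMetric φ p)⁻¹ = Real.exp (-(2 * φ p)) • Matrix.diagonal eta := by
  refine Matrix.inv_eq_right_inv ?_
  rw [conformalMetric, smul_mul_smul_comm, ← Real.exp_add, Matrix.diagonal_mul_diagonal]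
  simp [eta_mul_self]

theorem metricInner_conformalMetric (φ : R4 → ℝ) (p X Y : R4) :
    metricInner (conformalMetric φ) p X Y = Real.exp (2 * φ p) * minkowskiInner X Y := by
  simp [metricInner, minkowskiInner, conformalMetric, Matrix.diagonal_apply, Finset.mul_sum,
    mul_assoc]

section LeviCivita

variable {φ : R4 → ℝ} {v p : R4} (hφ : HasPartials φ v p)
include hφ

theorem partialD_conformalMetric (l i j : Fin 4) :
    partialD l (fun q => conformalMetric φ q i j) p =
      2 * Real.exp (2 * φ p) * v l * Matrix.diagonal eta i j := by
  have h : HasDerivAt (fun s => Real.exp (2 * s) * Matrix.diagonal eta i j)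
      (Real.exp (2 * φ p) * (2 * 1) * Matrix.diagonal eta i j) (φ p) :=
    (((hasDerivAt_id (φ p)).const_mul 2).exp).mul_const _
  refine ((HasPartials.scomp h hφ).partialD_eq l).trans ?_
  simp only [Pi.smul_apply, smul_eq_mul]
  ring

theorem christoffel_conformalMetric (k i j : Fin 4) :
    christoffel (conformalMetric φ) k i j p = (if k = j then v i else 0) +
      (if k = i then v j else 0) - if i = j then eta i * eta k * v k else 0 := by
  have hexp : Real.exp (-(2 * φ p)) * Real.exp (2 * φ p) = 1 := by
    rw [← Real.exp_add]; simp
  have hcancel : ∀ a b c : ℝ, 1 / 2 * (Real.exp (-(2 * φ p)) * eta k *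
      (2 * Real.exp (2 * φ p) * v i * a + 2 * Real.exp (2 * φ p) * v j * b -
        2 * Real.exp (2 * φ p) * v k * c)) = eta k * (v i * a + v j * b - v k * c) := by
    intro a b c
    linear_combination eta k * (v i * a + v j * b - v k * c) * hexp
  have hk := eta_mul_self k
  simp only [christoffel, conformalMetric_inv, partialD_conformalMetric hφ, Matrix.smul_apply,
    smul_eq_mul]
  rw [Finset.sum_eq_single k (fun l _ hl => by simp [Matrix.diagonal_apply, hl.symm]) (by simp)]
  simp only [Matrix.diagonal_apply, if_true, hcancel]
  by_cases h1 : k = j <;> by_cases h2 : k = i <;> by_cases h3 : i = j <;>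
    simp only [h1, h2, h3, eq_comm, if_true, if_false] at * <;> grind

theorem covDeriv_conformalMetric (X : R4) (U : R4 → R4) (k : Fin 4) :
    covDeriv (conformalMetric φ) X U p k = ∑ i, X i * partialD i (fun q => U q k) p +
      (∑ i, v i * X i) * U p k + X k * (∑ i, v i * U p i) -
        minkowskiInner X (U p) * (eta k * v k) := by
  simp only [covDeriv, christoffel_conformalMetric hφ, minkowskiInner]
  fin_cases k <;> simp [Fin.sum_univ_four] <;> ring

theorem divergence_conformalMetric (U : R4 → R4) :
    divergence (conformalMetric φ) U p =
      ∑ k, partialD k (fun q => U q k) p + 4 * ∑ i, v i * U p i := by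
  simp only [divergence, covDeriv_conformalMetric hφ, minkowskiInner]
  simp [Fin.sum_univ_four, eta]
  ring

end LeviCivita

/-! ### Unit vector fields of conformally flat metrics -/

/-- The Minkowski length `√|η(X, X)|`. -/
def minkowskiLength (X : R4) : ℝ := Real.sqrt |minkowskiInner X X|

/-- The vector field `V` normalized to unit length for the metric `e^{2φ} η`. It is `0` where `V` is
null. -/
def unitField (φ : R4 → ℝ) (V : R4 → R4) (p : R4) : R4 :=
  (Real.exp (-φ p) * (minkowskiLength (V p))⁻¹) • V p

theorem neg_normalized_gradient4_eq_unitField {F φ : R4 → ℝ} {V : R4 → R4} {p : R4}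
    (hF : HasPartials F (fun i => -(eta i * V p i)) p) :
    -(metricLength (conformalMetric φ) p (gradient4 (conformalMetric φ) F p))⁻¹ •
      gradient4 (conformalMetric φ) F p = unitField φ V p := by
  have hexp : Real.exp (-(2 * φ p)) = Real.exp (-φ p) * Real.exp (-φ p) := by
    rw [← Real.exp_add]; congr 1; ring
  have hexp' : Real.exp (2 * φ p) * Real.exp (-(2 * φ p)) = 1 := by
    rw [← Real.exp_add]; simp
  have hgrad : gradient4 (conformalMetric φ) F p = -Real.exp (-(2 * φ p)) • V p := by
    funext k
    simp only [gradient4, conformalMetric_inv, hF.partialD_eq]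
    simp only [Matrix.smul_apply, Matrix.diagonal_apply, smul_eq_mul, mul_ite, mul_zero, ite_mul,
      zero_mul, Finset.sum_ite_eq, Finset.mem_univ, if_true, Pi.smul_apply]
    linear_combination (-(Real.exp (-(2 * φ p)) * V p k)) * eta_mul_self k
  have hinner : metricInner (conformalMetric φ) p (gradient4 (conformalMetric φ) F p)
      (gradient4 (conformalMetric φ) F p) =
        Real.exp (-φ p) ^ 2 * minkowskiInner (V p) (V p) := by
    rw [metricInner_conformalMetric, hgrad]
    simp only [minkowskiInner_apply, Pi.smul_apply, smul_eq_mul]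
    rw [sq, ← hexp]
    linear_combination Real.exp (-(2 * φ p)) * (-(V p 0 * V p 0) + V p 1 * V p 1 +
      V p 2 * V p 2 + V p 3 * V p 3) * hexp'
  have hpos := Real.exp_pos (-φ p)
  rw [metricLength, hinner, abs_mul, abs_of_nonneg (by positivity), Real.sqrt_mul (by positivity),
    Real.sqrt_sq hpos.le, hgrad, unitField, minkowskiLength, smul_smul, hexp]
  congr 1
  field_simp

section UnitField

variable {φ : R4 → ℝ} {V : R4 → R4} {J : Matrix (Fin 4) (Fin 4) ℝ} {v p : R4}

theorem minkowskiLength_sq {X : R4} (hX : minkowskiInner X X < 0) :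
    minkowskiLength X ^ 2 = -minkowskiInner X X := by
  rw [minkowskiLength, Real.sq_sqrt (abs_nonneg _), abs_of_neg hX]

theorem minkowskiLength_pos {X : R4} (hX : minkowskiInner X X < 0) : 0 < minkowskiLength X :=
  Real.sqrt_pos.2 (abs_pos.2 hX.ne)

theorem hasPartials_minkowskiLength (hV : ∀ i, HasPartials (fun q => V q i) (J i) p)
    (hneg : minkowskiInner (V p) (V p) < 0) :
    HasPartials (fun q => minkowskiLength (V q))
      (fun j => -((minkowskiLength (V p))⁻¹ * minkowskiInner (V p) fun i => J i j)) p := by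
  have hW := minkowskiLength_pos hneg
  have hsq : ∀ i, HasPartials (fun q => eta i * V q i * V q i) ((2 * eta i * V p i) • J i) p := by
    intro i
    have h : HasDerivAt (fun s : ℝ => eta i * s * s) (2 * eta i * V p i) (V p i) :=
      (((hasDerivAt_id _).const_mul (eta i)).mul (hasDerivAt_id _)).congr_deriv (by simp; ring)
    exact HasPartials.scomp (F := fun q => V q i) h (hV i)
  have hinner : HasPartials (fun q => minkowskiInner (V q) (V q)) _ p := HasPartials.sum hsq
  have hsqrt : HasDerivAt (fun s : ℝ => Real.sqrt |s|) (-(1 / (2 * minkowskiLength (V p))))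
      (minkowskiInner (V p) (V p)) :=
    ((hasDerivAt_abs_neg hneg).sqrt (abs_pos.2 hneg.ne).ne').congr_deriv (by
      rw [minkowskiLength, neg_div])
  convert! HasPartials.scomp (F := fun q => minkowskiInner (V q) (V q)) hsqrt hinner using 1
  funext j
  simp only [minkowskiInner, Pi.smul_apply, smul_eq_mul, Finset.mul_sum, ← Finset.sum_neg_distrib]
  refine Finset.sum_congr rfl fun i _ => ?_
  field_simp

variable (hφ : HasPartials φ v p) (hV : ∀ i, HasPartials (fun q => V q i) (J i) p)
  (hneg : minkowskiInner (V p) (V p) < 0)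
include hφ hV hneg

theorem partialD_unitField (i k : Fin 4) :
    partialD i (fun q => unitField φ V q k) p =
      Real.exp (-φ p) * (minkowskiLength (V p))⁻¹ * (J k i + (minkowskiLength (V p))⁻¹ ^ 2 *
        minkowskiInner (V p) (fun j => J j i) * V p k - v i * V p k) := by
  have hW := minkowskiLength_pos hneg
  have hexp : HasDerivAt (fun s : ℝ => Real.exp (-s)) (Real.exp (-φ p) * -1) (φ p) :=
    (hasDerivAt_neg _).exp
  have h := ((HasPartials.scomp hexp hφ).mul (HasPartials.scomp (hasDerivAt_inv hW.ne')
    (hasPartials_minkowskiLength hV hneg))).mul (hV k)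
  refine (h.partialD_eq i).trans ?_
  simp only [Pi.smul_apply, Pi.add_apply, smul_eq_mul]
  field_simp
  ring

theorem divergence_unitField :
    divergence (conformalMetric φ) (unitField φ V) p =
      Real.exp (-φ p) * (minkowskiLength (V p))⁻¹ * (J.trace + (minkowskiLength (V p))⁻¹ ^ 2 *
        minkowskiInner (V p) (J *ᵥ V p) + 3 * ∑ i, v i * V p i) := by
  rw [divergence_conformalMetric hφ]
  simp only [partialD_unitField hφ hV hneg]
  simp only [unitField, minkowskiInner, Matrix.trace, Matrix.diag_apply, Matrix.mulVec, dotProduct,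
    Fin.sum_univ_four, Pi.smul_apply, smul_eq_mul]
  ring

theorem covDeriv_unitField {X : R4} (hX : minkowskiInner X (V p) = 0) (k : Fin 4) :
    covDeriv (conformalMetric φ) X (unitField φ V) p k =
      Real.exp (-φ p) * (minkowskiLength (V p))⁻¹ * ((J *ᵥ X) k + (∑ i, v i * V p i) * X k +
        (minkowskiLength (V p))⁻¹ ^ 2 * minkowskiInner (V p) (J *ᵥ X) * V p k) := by
  have hXu : minkowskiInner X (unitField φ V p) = 0 := by
    rw [unitField, minkowskiInner_smul_right, hX, mul_zero]
  rw [covDeriv_conformalMetric hφ, hXu]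
  simp only [partialD_unitField hφ hV hneg]
  simp only [unitField, minkowskiInner, Matrix.mulVec, dotProduct, Fin.sum_univ_four,
    Pi.smul_apply, smul_eq_mul]
  ring

theorem secondFF_unitField {X Y : R4} (hX : minkowskiInner X (V p) = 0)
    (hY : minkowskiInner Y (V p) = 0) :
    secondFF (conformalMetric φ) (unitField φ V) p X Y =
      Real.exp (φ p) * (minkowskiLength (V p))⁻¹ *
        (minkowskiInner (J *ᵥ X) Y + (∑ i, v i * V p i) * minkowskiInner X Y) := by
  have hexp : Real.exp (2 * φ p) * Real.exp (-φ p) = Real.exp (φ p) := by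
    rw [← Real.exp_add]
    congr 1
    ring
  rw [secondFF, metricInner_conformalMetric, ← hexp]
  simp only [minkowskiInner, covDeriv_unitField hφ hV hneg hX] at hY ⊢
  simp only [Fin.sum_univ_four] at hY ⊢
  linear_combination Real.exp (2 * φ p) * Real.exp (-φ p) * (minkowskiLength (V p))⁻¹ ^ 3 *
    (eta 0 * V p 0 * (J *ᵥ X) 0 + eta 1 * V p 1 * (J *ᵥ X) 1 + eta 2 * V p 2 * (J *ᵥ X) 2 +
      eta 3 * V p 3 * (J *ᵥ X) 3) * hY

end UnitField

/-! ### The radius -/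

theorem radius_nonneg (p : R4) : 0 ≤ radius p := Real.sqrt_nonneg _

theorem radius_sq (p : R4) : radius p ^ 2 = p 1 ^ 2 + p 2 ^ 2 + p 3 ^ 2 :=
  Real.sq_sqrt (by positivity)

theorem continuous_radius : Continuous radius := by
  unfold radius
  fun_prop

theorem radius_le_two_mul_norm (p : R4) : radius p ≤ 2 * ‖p‖ := by
  have h : ∀ i, p i ^ 2 ≤ ‖p‖ ^ 2 := fun i =>
    sq_le_sq' (abs_le.1 (norm_le_pi_norm p i)).1 (abs_le.1 (norm_le_pi_norm p i)).2
  refine abs_le_of_sq_le_sq' ?_ (by positivity) |>.2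
  rw [radius_sq]
  linarith [h 1, h 2, h 3, sq_nonneg ‖p‖]

/-- The spatial part `(0, x, y, z)` of a vector `(t, x, y, z)`. -/
def spatialPart (p : R4) : R4 := ![0, p 1, p 2, p 3]

theorem spatialPart_dotProduct_self (p : R4) : spatialPart p ⬝ᵥ spatialPart p = radius p ^ 2 := by
  simp only [dotProduct, Fin.sum_univ_four, spatialPart, Matrix.cons_val, radius_sq]
  ring

theorem spatialPart_eq_zero_iff {p : R4} : spatialPart p = 0 ↔ radius p = 0 := by
  rw [← sq_eq_zero_iff (a := radius p), ← spatialPart_dotProduct_self, dotProduct_self_eq_zero]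

theorem apply_eq_zero_of_radius_eq_zero {p : R4} (hp : radius p = 0) {i : Fin 4} (hi : i ≠ 0) :
    p i = 0 := by
  have h := congrFun (spatialPart_eq_zero_iff.2 hp) i
  fin_cases i
  exacts [absurd rfl hi, h, h, h]

theorem spatialPart_dotProduct_sq_le (p X : R4) :
    (spatialPart p ⬝ᵥ X) ^ 2 ≤ radius p ^ 2 * (X 1 ^ 2 + X 2 ^ 2 + X 3 ^ 2) := by
  simp only [dotProduct, Fin.sum_univ_four, spatialPart, Matrix.cons_val, radius_sq]
  linarith [sq_nonneg (p 1 * X 2 - p 2 * X 1), sq_nonneg (p 1 * X 3 - p 3 * X 1),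
    sq_nonneg (p 2 * X 3 - p 3 * X 2)]

theorem hasPartials_radius {p : R4} (hp : 0 < radius p) :
    HasPartials radius ((radius p)⁻¹ • spatialPart p) p := by
  have hsq : ∀ i, HasPartials (fun q => q i ^ 2) ((2 * p i) • Pi.single i 1) p := fun i =>
    HasPartials.scomp (F := fun q => q i) (by simpa using hasDerivAt_pow 2 (p i))
      (hasPartials_coord p i)
  have hsqrt := Real.hasDerivAt_sqrt (x := p 1 ^ 2 + p 2 ^ 2 + p 3 ^ 2)
    (by rw [← radius_sq]; positivity)
  convert! HasPartials.scomp (F := fun q => q 1 ^ 2 + q 2 ^ 2 + q 3 ^ 2) hsqrt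
    (((hsq 1).add (hsq 2)).add (hsq 3)) using 1
  change _ = (1 / (2 * radius p)) • _
  funext i
  fin_cases i <;> simp [spatialPart] <;> field_simp

theorem hasPartials_comp_radius_of_radius_eq_zero {g : ℝ → ℝ} (hg : HasDerivAt g 0 0) {p : R4}
    (hp : radius p = 0) : HasPartials (fun q => g (radius q)) 0 p := by
  have hradius : ∀ q, radius q = radius (q - p) := fun q => by
    simp [radius, apply_eq_zero_of_radius_eq_zero hp]
  have hr : (fun q => radius q) =O[𝓝 p] fun q => q - p := by
    refine IsBigO.of_bound 2 (Eventually.of_forall fun q => ?_)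
    rw [Real.norm_of_nonneg (radius_nonneg q), hradius]
    exact radius_le_two_mul_norm _
  have ht : Tendsto radius (𝓝 p) (𝓝 0) := by
    simpa only [hp] using continuous_radius.tendsto p
  rw [hasDerivAt_iff_isLittleO] at hg
  rw [HasPartials, hasFDerivAt_iff_isLittleO]
  have h := (hg.comp_tendsto ht).trans_isBigO (by simpa [Function.comp_def] using hr)
  simpa [Function.comp_def, linearForm_apply, hp] using h

/-! ### The unit field of the spacetime -/

/-- The vector field `V = (t, k x, k y, k z) = t ∂ₜ + h ∂ᵣ`. It is minus the Minkowski gradient of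
`ζ`, so `u` is its normalization. -/
def flowField (f : ℝ → ℝ) (p : R4) : R4 :=
  ![p 0, radialFactor f (radius p) * p 1, radialFactor f (radius p) * p 2,
    radialFactor f (radius p) * p 3]

/-- The Jacobian of `flowField f`: on spatial vectors it is `k δ + (k' / r) x ⊗ x`. -/
def flowJacobian (f : ℝ → ℝ) (p : R4) : Matrix (Fin 4) (Fin 4) ℝ :=
  radialFactor f (radius p) • 1 + (1 - radialFactor f (radius p)) • Matrix.single 0 0 1 +
    anisotropy f (radius p) • Matrix.vecMulVec (spatialPart p) (spatialPart p)

theorem flowJacobian_mulVec (f : ℝ → ℝ) (p X : R4) :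
    flowJacobian f p *ᵥ X = radialFactor f (radius p) • X +
      Pi.single 0 ((1 - radialFactor f (radius p)) * X 0) +
        (anisotropy f (radius p) * (spatialPart p ⬝ᵥ X)) • spatialPart p := by
  simp only [flowJacobian, Matrix.add_mulVec, Matrix.smul_mulVec, Matrix.one_mulVec,
    Matrix.single_mulVec, Matrix.vecMulVec_mulVec]
  funext i
  simp only [Pi.add_apply, Pi.smul_apply, smul_eq_mul, MulOpposite.smul_eq_mul_unop,
    MulOpposite.unop_op, Pi.single_apply, Function.update_apply]
  split_ifs <;> simp <;> ring

theorem trace_flowJacobian (f : ℝ → ℝ) (p : R4) :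
    (flowJacobian f p).trace = 1 + 3 * radialFactor f (radius p) +
      anisotropy f (radius p) * radius p ^ 2 := by
  simp only [flowJacobian, Matrix.trace_add, Matrix.trace_smul, Matrix.trace_one,
    Matrix.trace_single_eq_same, Matrix.trace_vecMulVec, spatialPart_dotProduct_self, smul_eq_mul,
    Fintype.card_fin]
  push_cast
  ring

theorem spacetimeG_eq_conformalMetric (f Φ : ℝ → ℝ) :
    spacetimeG f Φ = conformalMetric fun q => Φ (zeta f q) := rfl

theorem integral_div_halfDeriv_eq {f : ℝ → ℝ} {r : ℝ} (hr : 0 ≤ r) :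
    ∫ s in (0 : ℝ)..r, f s / halfDeriv f s = ∫ s in (0 : ℝ)..r, radialPart f (max s 0) :=
  intervalIntegral.integral_congr fun s hs => by
    rw [uIcc_of_le hr] at hs
    simp only [radialPart, max_eq_left hs.1]

namespace IsProfile

variable {f : ℝ → ℝ} (hf : IsProfile f)
include hf

theorem continuous_radialFactor_radius : Continuous fun p => radialFactor f (radius p) :=
  hf.continuousOn_radialFactor.comp_continuous continuous_radius radius_nonneg

theorem hasPartials_radialFactor_mul_coord (p : R4) {i : Fin 4} (hi : i ≠ 0) :
    HasPartials (fun q => radialFactor f (radius q) * q i)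
      (radialFactor f (radius p) • Pi.single i 1 +
        (anisotropy f (radius p) * p i) • spatialPart p) p := by
  rcases (radius_nonneg p).eq_or_lt with h | h
  · rw [spatialPart_eq_zero_iff.2 h.symm, smul_zero, add_zero]
    exact hasPartials_mul_of_continuousAt hf.continuous_radialFactor_radius.continuousAt
      (hasPartials_coord p i) (apply_eq_zero_of_radius_eq_zero h.symm hi)
  · convert (HasPartials.scomp (hf.hasDerivAt_radialFactor h) (hasPartials_radius h)).mul
      (hasPartials_coord p i) using 2
    rw [smul_smul, smul_smul]
    congr 1
    field_simp

theorem hasPartials_flowField (p : R4) (i : Fin 4) :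
    HasPartials (fun q => flowField f q i) (flowJacobian f p i) p := by
  have hrow : ∀ j, j ≠ 0 → flowJacobian f p j = radialFactor f (radius p) • Pi.single j 1 +
      (anisotropy f (radius p) * spatialPart p j) • spatialPart p := by
    intro j hj
    funext l
    simp [flowJacobian, Matrix.one_apply, Matrix.vecMulVec_apply,
      Pi.single_apply, hj.symm, mul_assoc, eq_comm]
  have htime : flowJacobian f p 0 = Pi.single 0 1 := by
    funext l
    fin_cases l <;> simp [flowJacobian, spatialPart]
  fin_cases i
  · exact htime ▸ hasPartials_coord p 0
  · exact hrow 1 (by decide) ▸ hf.hasPartials_radialFactor_mul_coord p (i := 1) (by decide)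
  · exact hrow 2 (by decide) ▸ hf.hasPartials_radialFactor_mul_coord p (i := 2) (by decide)
  · exact hrow 3 (by decide) ▸ hf.hasPartials_radialFactor_mul_coord p (i := 3) (by decide)

theorem hasDerivAt_integral_radialPart {r : ℝ} (hr : 0 ≤ r) :
    HasDerivAt (fun r => ∫ s in (0 : ℝ)..r, radialPart f (max s 0)) (radialPart f r) r := by
  have hc : Continuous fun s : ℝ => radialPart f (max s 0) :=
    hf.continuousOn_radialPart.comp_continuous (by fun_prop) fun s => le_max_right s 0
  simpa only [max_eq_left hr] using (hc.integral_hasStrictDerivAt 0 r).hasDerivAt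

theorem hasPartials_integral_radius (p : R4) :
    HasPartials (fun q => ∫ s in (0 : ℝ)..radius q, f s / halfDeriv f s)
      (radialFactor f (radius p) • spatialPart p) p := by
  have hext : (fun q => ∫ s in (0 : ℝ)..radius q, f s / halfDeriv f s) =
      fun q => ∫ s in (0 : ℝ)..radius q, radialPart f (max s 0) :=
    funext fun q => integral_div_halfDeriv_eq (radius_nonneg q)
  have hd := hf.hasDerivAt_integral_radialPart (radius_nonneg p)
  rw [hext]
  rcases (radius_nonneg p).eq_or_lt with h | h
  · rw [← h, hf.radialPart_zero] at hd
    rw [spatialPart_eq_zero_iff.2 h.symm, smul_zero]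
    exact hasPartials_comp_radius_of_radius_eq_zero hd h.symm
  · convert HasPartials.scomp hd (hasPartials_radius h) using 1
    rw [smul_smul, ← hf.radialFactor_mul_self, mul_inv_cancel_right₀ h.ne']

theorem hasPartials_zeta (p : R4) :
    HasPartials (zeta f) (fun i => -(eta i * flowField f p i)) p := by
  have htime : HasPartials (fun q : R4 => q 0 ^ 2 / 2) (p 0 • Pi.single 0 1) p :=
    HasPartials.scomp (F := fun q => q 0)
      (((hasDerivAt_pow 2 (p 0)).div_const 2).congr_deriv (by simp)) (hasPartials_coord p 0)
  have hspace := HasPartials.scomp (hasDerivAt_neg _) (hf.hasPartials_integral_radius p)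
  convert! htime.add hspace using 1
  funext i
  fin_cases i <;> simp [eta, flowField, spatialPart]

theorem continuous_zeta : Continuous (zeta f) :=
  continuous_iff_continuousAt.2 fun p => (hf.hasPartials_zeta p).continuousAt

theorem fluidU_eq_unitField (Φ : ℝ → ℝ) :
    fluidU f Φ = unitField (fun q => Φ (zeta f q)) (flowField f) :=
  funext fun p => neg_normalized_gradient4_eq_unitField (hf.hasPartials_zeta p)

theorem minkowskiInner_flowField_self (p : R4) :
    minkowskiInner (flowField f p) (flowField f p) = radialPart f (radius p) ^ 2 - p 0 ^ 2 := by
  rw [← hf.radialFactor_mul_self, mul_pow, radius_sq]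
  simp only [minkowskiInner_apply, flowField, Matrix.cons_val]
  ring

theorem minkowskiInner_flowField_flowJacobian_mulVec (p : R4) :
    minkowskiInner (flowField f p) (flowJacobian f p *ᵥ flowField f p) =
      radialPartDeriv f (radius p) * radialPart f (radius p) ^ 2 - p 0 ^ 2 := by
  have hb := hf.anisotropy_mul_sq (radius_nonneg p)
  rw [← hf.radialFactor_mul_self, mul_pow, flowJacobian_mulVec, eq_add_of_sub_eq hb.symm, radius_sq]
  simp only [minkowskiInner_apply, flowField, spatialPart, dotProduct, Fin.sum_univ_four,
    Pi.add_apply, Pi.smul_apply, smul_eq_mul, Pi.single_apply, Matrix.cons_val]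
  simp only [Fin.reduceEq, if_true, if_false]
  ring

variable {p : R4} (hp : p ∈ spacetimeM f)
include hp

theorem time_pos : 0 < p 0 := (hf.nonneg (radius_nonneg p)).trans_lt hp

theorem minkowskiInner_flowField_self_neg :
    minkowskiInner (flowField f p) (flowField f p) < 0 := by
  rw [hf.minkowskiInner_flowField_self, sub_neg]
  exact pow_lt_pow_left₀ ((hf.radialPart_le (radius_nonneg p)).trans_lt hp)
    (hf.radialPart_nonneg (radius_nonneg p)) two_ne_zero

theorem minkowskiLength_flowField_pos : 0 < minkowskiLength (flowField f p) :=
  minkowskiLength_pos (hf.minkowskiInner_flowField_self_neg hp)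

theorem minkowskiLength_flowField_sq :
    minkowskiLength (flowField f p) ^ 2 = p 0 ^ 2 - radialPart f (radius p) ^ 2 := by
  rw [minkowskiLength_sq (hf.minkowskiInner_flowField_self_neg hp),
    hf.minkowskiInner_flowField_self, neg_sub]

theorem sum_partials_conformalFactor_mul_flowField (c : ℝ) :
    ∑ i, (c • fun i => -(eta i * flowField f p i)) i * flowField f p i =
      c * minkowskiLength (flowField f p) ^ 2 := by
  rw [minkowskiLength_sq (hf.minkowskiInner_flowField_self_neg hp)]
  simp only [minkowskiInner, Pi.smul_apply, smul_eq_mul, Fin.sum_univ_four]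
  ring

variable {Φ : ℝ → ℝ} (hΦ : Differentiable ℝ Φ)
include hΦ

theorem meanCurv_eq : meanCurv (spacetimeG f Φ) (fluidU f Φ) p =
    Real.exp (-Φ (zeta f p)) / 3 *
      ((radialPartDeriv f (radius p) * p 0 ^ 2 - radialPart f (radius p) ^ 2) /
          minkowskiLength (flowField f p) ^ 3 +
        2 * radialFactor f (radius p) / minkowskiLength (flowField f p) +
        3 * deriv Φ (zeta f p) * minkowskiLength (flowField f p)) := by
  have hW := hf.minkowskiLength_flowField_pos hp
  have hWsq := hf.minkowskiLength_flowField_sq hp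
  have hb := hf.anisotropy_mul_sq (radius_nonneg p)
  rw [meanCurv, spacetimeG_eq_conformalMetric, hf.fluidU_eq_unitField,
    divergence_unitField (HasPartials.scomp (hΦ _).hasDerivAt (hf.hasPartials_zeta p))
      (hf.hasPartials_flowField p) (hf.minkowskiInner_flowField_self_neg hp),
    hf.sum_partials_conformalFactor_mul_flowField hp,
    hf.minkowskiInner_flowField_flowJacobian_mulVec, trace_flowJacobian, hb]
  generalize minkowskiLength (flowField f p) = W at *
  field_simp
  linear_combination (1 + radialPartDeriv f (radius p)) * hWsq

theorem secondFF_eq {X Y : R4} (hX : minkowskiInner X (flowField f p) = 0)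
    (hY : minkowskiInner Y (flowField f p) = 0) :
    secondFF (spacetimeG f Φ) (fluidU f Φ) p X Y =
      Real.exp (Φ (zeta f p)) * (minkowskiLength (flowField f p))⁻¹ *
        ((radialFactor f (radius p) + deriv Φ (zeta f p) * minkowskiLength (flowField f p) ^ 2) *
            minkowskiInner X Y + (radialFactor f (radius p) - 1) * (X 0 * Y 0) +
          anisotropy f (radius p) * ((spatialPart p ⬝ᵥ X) * (spatialPart p ⬝ᵥ Y))) := by
  rw [spacetimeG_eq_conformalMetric, hf.fluidU_eq_unitField,
    secondFF_unitField (HasPartials.scomp (hΦ _).hasDerivAt (hf.hasPartials_zeta p))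
      (hf.hasPartials_flowField p) (hf.minkowskiInner_flowField_self_neg hp) hX hY,
    hf.sum_partials_conformalFactor_mul_flowField hp, flowJacobian_mulVec]
  simp only [minkowskiInner_apply, Pi.add_apply, Pi.smul_apply, smul_eq_mul, Pi.single_apply,
    spatialPart, dotProduct, Fin.sum_univ_four, Matrix.cons_val]
  simp only [Fin.reduceEq, if_true, if_false]
  ring

end IsProfile

/-! ### The shear -/

theorem spatial_sq_mul_le_of_minkowskiInner_eq_zero {X V : R4} (h : minkowskiInner X V = 0) :
    (X 1 ^ 2 + X 2 ^ 2 + X 3 ^ 2) * -minkowskiInner V V ≤ minkowskiInner X X * V 0 ^ 2 := by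
  rw [minkowskiInner_apply] at h
  have horth : (X 0 * V 0) ^ 2 = (X 1 * V 1 + X 2 * V 2 + X 3 * V 3) ^ 2 := by
    congr 1
    linarith
  simp only [minkowskiInner_apply]
  linarith [sq_nonneg (X 1 * V 2 - X 2 * V 1), sq_nonneg (X 1 * V 3 - X 3 * V 1),
    sq_nonneg (X 2 * V 3 - X 3 * V 2)]

theorem spatial_sq_le_of_minkowskiInner_eq_zero {X V : R4} {E κ : ℝ} (hκ : 0 < κ) (hV : 0 < V 0)
    (hneg : minkowskiInner V V < 0) (hle : κ * V 0 ≤ minkowskiLength V)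
    (hXV : minkowskiInner X V = 0) (hXX : minkowskiInner X X = E ^ 2) :
    X 1 ^ 2 + X 2 ^ 2 + X 3 ^ 2 ≤ (E / κ) ^ 2 := by
  have h := spatial_sq_mul_le_of_minkowskiInner_eq_zero hXV
  rw [← minkowskiLength_sq hneg, hXX] at h
  have hle' : (X 1 ^ 2 + X 2 ^ 2 + X 3 ^ 2) * (κ * V 0) ^ 2 ≤ E ^ 2 * V 0 ^ 2 :=
    (by gcongr : _ ≤ _).trans h
  rw [mul_pow, ← mul_assoc] at hle'
  rw [div_pow, le_div_iff₀ (by positivity)]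
  exact le_of_mul_le_mul_right hle' (by positivity)

namespace IsRestFrame

variable {φ : R4 → ℝ} {V : R4 → R4} {p : R4} {e : Fin 3 → R4}
  (he : IsRestFrame (conformalMetric φ) (unitField φ V) p e)
include he

theorem minkowskiInner_eq_zero (hneg : minkowskiInner (V p) (V p) < 0) (i : Fin 3) :
    minkowskiInner (e i) (V p) = 0 := by
  have h := he.1 i
  have hW := minkowskiLength_pos hneg
  rw [metricInner_conformalMetric, unitField, minkowskiInner_smul_right, ← mul_assoc] at h
  exact (mul_eq_zero.1 h).resolve_left (by positivity)

theorem minkowskiInner_eq (i j : Fin 3) :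
    minkowskiInner (e i) (e j) = Real.exp (-φ p) ^ 2 * if i = j then 1 else 0 := by
  have hexp : Real.exp (-φ p) ^ 2 * Real.exp (2 * φ p) = 1 := by
    rw [← Real.exp_nat_mul, ← Real.exp_add]
    simp
  rw [← he.2 i j, metricInner_conformalMetric, ← mul_assoc, hexp, one_mul]

end IsRestFrame

namespace IsProfile

variable {f : ℝ → ℝ} (hf : IsProfile f)
include hf

section Estimates

variable {r β C a a' d d' t : ℝ} (hr : 0 ≤ r)
  (hk : |radialFactor f r - 1| ≤ β * r) (hh : |radialPartDeriv f r - radialFactor f r| ≤ β * r)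
include hr hk hh

theorem abs_frame_part_le (ha : |a| ≤ C) (ha' : |a'| ≤ C) (hd : |d| ≤ r * C)
    (hd' : |d'| ≤ r * C) :
    |(radialFactor f r - 1) * (a * a') + anisotropy f r * (d * d')| ≤ 2 * (β * r * C ^ 2) := by
  have hC : 0 ≤ C := (abs_nonneg a).trans ha
  have hβr : 0 ≤ β * r := (abs_nonneg _).trans hk
  have htime : |(radialFactor f r - 1) * (a * a')| ≤ β * r * (C * C) := by
    rw [abs_mul, abs_mul]
    gcongr
  have hspace : |anisotropy f r * (d * d')| ≤ β * r * C ^ 2 := by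
    calc |anisotropy f r * (d * d')|
        ≤ |anisotropy f r| * ((r * C) * (r * C)) := by
          rw [abs_mul, abs_mul]
          gcongr
      _ = |anisotropy f r * r ^ 2| * C ^ 2 := by
          rw [abs_mul, abs_of_nonneg (sq_nonneg r)]
          ring
      _ ≤ β * r * C ^ 2 := by
          rw [hf.anisotropy_mul_sq hr]
          gcongr
  linarith [abs_add_le ((radialFactor f r - 1) * (a * a')) (anisotropy f r * (d * d'))]

theorem abs_trace_part_le (ht : radialPart f r ≤ t) :
    |t ^ 2 * (radialFactor f r - radialPartDeriv f r) +
      radialPart f r ^ 2 * (1 - radialFactor f r)| ≤ 2 * (β * r * t ^ 2) := by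
  have h0 := hf.radialPart_nonneg hr
  have htime : |t ^ 2 * (radialFactor f r - radialPartDeriv f r)| ≤ t ^ 2 * (β * r) := by
    rw [abs_mul, abs_of_nonneg (sq_nonneg t), abs_sub_comm]
    gcongr
  have hspace : |radialPart f r ^ 2 * (1 - radialFactor f r)| ≤ t ^ 2 * (β * r) := by
    rw [abs_mul, abs_of_nonneg (sq_nonneg _), abs_sub_comm]
    gcongr
  linarith [abs_add_le (t ^ 2 * (radialFactor f r - radialPartDeriv f r))
    (radialPart f r ^ 2 * (1 - radialFactor f r))]

end Estimates

section RestFrame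

variable {p : R4} (hp : p ∈ spacetimeM f) {Φ : ℝ → ℝ} (hΦ : Differentiable ℝ Φ)
  {e : Fin 3 → R4} (he : IsRestFrame (spacetimeG f Φ) (fluidU f Φ) p e)
include he

theorem minkowskiInner_restFrame (i j : Fin 3) :
    minkowskiInner (e i) (e j) = Real.exp (-Φ (zeta f p)) ^ 2 * if i = j then 1 else 0 := by
  rw [spacetimeG_eq_conformalMetric, hf.fluidU_eq_unitField] at he
  exact he.minkowskiInner_eq i j

include hp

theorem minkowskiInner_restFrame_flowField (i : Fin 3) :
    minkowskiInner (e i) (flowField f p) = 0 := by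
  rw [spacetimeG_eq_conformalMetric, hf.fluidU_eq_unitField] at he
  exact he.minkowskiInner_eq_zero (hf.minkowskiInner_flowField_self_neg hp) i

theorem abs_restFrame_le {κ : ℝ} (hκ : 0 < κ) (hle : κ * p 0 ≤ minkowskiLength (flowField f p))
    (i : Fin 3) : |e i 0| ≤ Real.exp (-Φ (zeta f p)) / κ ∧
      |spatialPart p ⬝ᵥ e i| ≤ radius p * (Real.exp (-Φ (zeta f p)) / κ) := by
  have ht : 0 < flowField f p 0 := hf.time_pos (p := p) hp
  have hnorm : minkowskiInner (e i) (e i) = Real.exp (-Φ (zeta f p)) ^ 2 := by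
    simpa using hf.minkowskiInner_restFrame he i i
  have hspace := spatial_sq_le_of_minkowskiInner_eq_zero hκ ht
    (hf.minkowskiInner_flowField_self_neg hp) hle (hf.minkowskiInner_restFrame_flowField hp he i)
    hnorm
  rw [minkowskiInner_apply] at hnorm
  refine ⟨abs_le_of_sq_le_sq (by linarith [sq_nonneg (Real.exp (-Φ (zeta f p)))]) (by positivity),
    abs_le_of_sq_le_sq ?_ (mul_nonneg (radius_nonneg p) (by positivity))⟩
  rw [mul_pow]
  exact (spatialPart_dotProduct_sq_le p (e i)).trans (by gcongr)

include hΦ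

theorem shear_restFrame_eq (i j : Fin 3) :
    secondFF (spacetimeG f Φ) (fluidU f Φ) p (e i) (e j) -
      (if i = j then meanCurv (spacetimeG f Φ) (fluidU f Φ) p else 0) =
    Real.exp (Φ (zeta f p)) * (minkowskiLength (flowField f p))⁻¹ *
        ((radialFactor f (radius p) - 1) * (e i 0 * e j 0) +
          anisotropy f (radius p) * ((spatialPart p ⬝ᵥ e i) * (spatialPart p ⬝ᵥ e j))) +
      (if i = j then 1 else 0) *
        (Real.exp (-Φ (zeta f p)) / (3 * minkowskiLength (flowField f p) ^ 3) *
          (p 0 ^ 2 * (radialFactor f (radius p) - radialPartDeriv f (radius p)) +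
            radialPart f (radius p) ^ 2 * (1 - radialFactor f (radius p)))) := by
  have hW := hf.minkowskiLength_flowField_pos hp
  rw [hf.secondFF_eq hp hΦ (hf.minkowskiInner_restFrame_flowField hp he i)
    (hf.minkowskiInner_restFrame_flowField hp he j), hf.minkowskiInner_restFrame he i j,
    hf.meanCurv_eq hp hΦ, Real.exp_neg]
  split_ifs
  · field_simp
    linear_combination radialFactor f (radius p) * hf.minkowskiLength_flowField_sq hp
  · field_simp
    ring

variable {κ β : ℝ} (hκ : 0 < κ) (hle : κ * p 0 ≤ minkowskiLength (flowField f p))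
  (hk : |radialFactor f (radius p) - 1| ≤ β * radius p)
  (hh : |radialPartDeriv f (radius p) - radialFactor f (radius p)| ≤ β * radius p)
include hκ hle hk hh

theorem abs_shear_restFrame_le (hβ : 0 ≤ β) (i j : Fin 3) :
    |secondFF (spacetimeG f Φ) (fluidU f Φ) p (e i) (e j) -
      (if i = j then meanCurv (spacetimeG f Φ) (fluidU f Φ) p else 0)| ≤
      3 * (β * (Real.exp (-Φ (zeta f p)) / κ ^ 3)) := by
  have hr := radius_nonneg p
  have ht := hf.time_pos hp
  have hrt : radius p ≤ p 0 := (hf.self_le_apply hr).trans (le_of_lt hp)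
  have hframe := hf.abs_frame_part_le hr hk hh (hf.abs_restFrame_le hp he hκ hle i).1
    (hf.abs_restFrame_le hp he hκ hle j).1 (hf.abs_restFrame_le hp he hκ hle i).2
    (hf.abs_restFrame_le hp he hκ hle j).2
  have htrace := hf.abs_trace_part_le hr hk hh ((hf.radialPart_le hr).trans (le_of_lt hp))
  have hexp : Real.exp (Φ (zeta f p)) * Real.exp (-Φ (zeta f p)) = 1 := by
    rw [← Real.exp_add]
    simp
  have hW : 0 < κ * p 0 := by positivity
  rw [hf.shear_restFrame_eq hp hΦ he]
  generalize (radialFactor f (radius p) - 1) * _ + _ = A at *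
  generalize p 0 ^ 2 * _ + _ = B at *
  generalize minkowskiLength (flowField f p) = W at *
  set E := Real.exp (-Φ (zeta f p))
  have hWpos := hW.trans_le hle
  have hA : |Real.exp (Φ (zeta f p)) * W⁻¹ * A| ≤ 2 * (β * (E / κ ^ 3)) := by
    calc |Real.exp (Φ (zeta f p)) * W⁻¹ * A| = Real.exp (Φ (zeta f p)) * W⁻¹ * |A| := by
          rw [abs_mul, abs_of_nonneg (by positivity)]
      _ ≤ Real.exp (Φ (zeta f p)) * (κ * p 0)⁻¹ * (2 * (β * p 0 * (E / κ) ^ 2)) := by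
          gcongr
          exact hframe.trans (by gcongr)
      _ = 2 * (β * (E / κ ^ 3)) * (Real.exp (Φ (zeta f p)) * E) := by field_simp
      _ = 2 * (β * (E / κ ^ 3)) := by rw [hexp, mul_one]
  have hB : |(if i = j then (1 : ℝ) else 0) * (E / (3 * W ^ 3) * B)| ≤ β * (E / κ ^ 3) := by
    calc _ ≤ 1 * (E / (3 * W ^ 3) * |B|) := by
          rw [abs_mul, abs_mul, abs_of_nonneg (by positivity : 0 ≤ E / (3 * W ^ 3))]
          gcongr
          split_ifs <;> simp
      _ ≤ 1 * (E / (3 * (κ * p 0) ^ 3) * (2 * (β * p 0 * p 0 ^ 2))) := by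
          gcongr
          exact htrace.trans (by gcongr)
      _ = 2 / 3 * (β * (E / κ ^ 3)) := by field_simp
      _ ≤ β * (E / κ ^ 3) := by linarith [show 0 ≤ β * (E / κ ^ 3) by positivity]
  exact (abs_add_le _ _).trans (by linarith)

theorem shearSq_le (hβ : 0 ≤ β) :
    shearSq (spacetimeG f Φ) (fluidU f Φ) p e ≤
      (9 * (β * (Real.exp (-Φ (zeta f p)) / κ ^ 3))) ^ 2 := by
  have hentry : ∀ i j : Fin 3, (secondFF (spacetimeG f Φ) (fluidU f Φ) p (e i) (e j) -
      if i = j then meanCurv (spacetimeG f Φ) (fluidU f Φ) p else 0) ^ 2 ≤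
        (3 * (β * (Real.exp (-Φ (zeta f p)) / κ ^ 3))) ^ 2 := fun i j =>
    sq_le_sq' (abs_le.1 (hf.abs_shear_restFrame_le hp hΦ he hκ hle hk hh hβ i j)).1
      (abs_le.1 (hf.abs_shear_restFrame_le hp hΦ he hκ hle hk hh hβ i j)).2
  refine (Finset.sum_le_sum fun i _ => Finset.sum_le_sum fun j _ => hentry i j).trans_eq ?_
  simp only [Finset.sum_const, Finset.card_univ, Fintype.card_fin, nsmul_eq_mul]
  ring

end RestFrame

theorem spacetimeMEps_subset {ε : ℝ} (hε : 0 < ε) : spacetimeMEps f ε ⊆ spacetimeM f :=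
  fun p hp => (le_mul_of_one_le_left (hf.nonneg (radius_nonneg p)) (by linarith)).trans_lt hp

theorem exists_mul_time_le_minkowskiLength {ε : ℝ} (hε : 0 < ε) :
    ∃ κ > 0, ∀ p ∈ spacetimeMEps f ε, κ * p 0 ≤ minkowskiLength (flowField f p) := by
  have hκ : 0 < 1 - 1 / (1 + ε) ^ 2 :=
    sub_pos.2 ((div_lt_one (by positivity)).2 (one_lt_pow₀ (by linarith) two_ne_zero))
  refine ⟨Real.sqrt (1 - 1 / (1 + ε) ^ 2), Real.sqrt_pos.2 hκ, fun p hpε => ?_⟩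
  have hp := hf.spacetimeMEps_subset hε hpε
  have hh : radialPart f (radius p) ≤ p 0 / (1 + ε) := by
    rw [le_div_iff₀ (by positivity), mul_comm]
    exact (mul_le_mul_of_nonneg_left (hf.radialPart_le (radius_nonneg p)) (by positivity)).trans
      (le_of_lt hpε)
  refine (abs_le_of_sq_le_sq' ?_ (hf.minkowskiLength_flowField_pos hp).le).2
  rw [hf.minkowskiLength_flowField_sq hp, mul_pow, Real.sq_sqrt hκ.le]
  have hsq := pow_le_pow_left₀ (hf.radialPart_nonneg (radius_nonneg p)) hh 2
  rw [div_pow] at hsq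
  linarith [show (1 - 1 / (1 + ε) ^ 2) * p 0 ^ 2 = p 0 ^ 2 - p 0 ^ 2 / (1 + ε) ^ 2 by ring]

theorem eventually_shearSq_lt {Φ : ℝ → ℝ} (hΦ : Differentiable ℝ Φ) {ε δ : ℝ} (hε : 0 < ε)
    (hδ : 0 < δ) : ∀ᶠ p in 𝓝[spacetimeMEps f ε] (0 : R4), ∀ e : Fin 3 → R4,
      IsRestFrame (spacetimeG f Φ) (fluidU f Φ) p e →
        shearSq (spacetimeG f Φ) (fluidU f Φ) p e < δ := by
  obtain ⟨κ, hκ, hle⟩ := hf.exists_mul_time_le_minkowskiLength hε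
  have hcont : Continuous fun p => Real.exp (-Φ (zeta f p)) / κ ^ 3 :=
    (Real.continuous_exp.comp (hΦ.continuous.comp hf.continuous_zeta).neg).div_const _
  obtain ⟨D, hD⟩ := exists_gt (Real.exp (-Φ (zeta f 0)) / κ ^ 3)
  have hDpos : 0 < D := (by positivity : (0 : ℝ) ≤ _).trans_lt hD
  have hβ : 0 < Real.sqrt δ / (9 * D) := by positivity
  have hr : Tendsto radius (𝓝[spacetimeMEps f ε] (0 : R4)) (𝓝[≥] 0) :=
    tendsto_nhdsWithin_iff.2 ⟨(continuous_radius.tendsto' 0 0 (by simp [radius])).mono_left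
      nhdsWithin_le_nhds, Eventually.of_forall radius_nonneg⟩
  filter_upwards [hr.eventually (hf.isLittleO_radialFactor_sub_one.def hβ),
    hr.eventually (hf.isLittleO_radialPartDeriv_sub_radialFactor.def hβ),
    nhdsWithin_le_nhds (hcont.continuousAt.eventually_lt continuousAt_const hD),
    self_mem_nhdsWithin] with p hk hh hpD hpε e he
  simp only [Real.norm_eq_abs, abs_of_nonneg (radius_nonneg p)] at hk hh
  calc shearSq (spacetimeG f Φ) (fluidU f Φ) p e
      ≤ (9 * (Real.sqrt δ / (9 * D) * (Real.exp (-Φ (zeta f p)) / κ ^ 3))) ^ 2 :=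
        hf.shearSq_le (hf.spacetimeMEps_subset hε hpε) hΦ he hκ (hle p hpε) hk hh hβ.le
    _ < (9 * (Real.sqrt δ / (9 * D) * D)) ^ 2 := by gcongr
    _ = δ := by
        rw [show 9 * (Real.sqrt δ / (9 * D) * D) = Real.sqrt δ by field_simp, Real.sq_sqrt hδ.le]

end IsProfile

/-! ### Comoving observers and their trajectories -/

/-- The parameter `μ = t / f(r)` of the trajectory through a point, with `μ = ∞` on `r = 0`. -/
def trajectoryParam (f : ℝ → ℝ) (p : R4) : WithTop ℝ :=
  if radius p = 0 then ⊤ else ((p 0 / f (radius p) : ℝ) : WithTop ℝ)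

theorem spatialPart_dotProduct_flowField (f : ℝ → ℝ) (p : R4) :
    spatialPart p ⬝ᵥ flowField f p = radialFactor f (radius p) * radius p ^ 2 := by
  simp only [dotProduct, Fin.sum_univ_four, spatialPart, flowField, Matrix.cons_val, radius_sq]
  ring

namespace IsComovingObserver

variable {f Φ : ℝ → ℝ} {b τ : ℝ} {γ : ℝ → R4} (hγ : IsComovingObserver f Φ b γ)
include hγ

theorem mem (hτ : τ ∈ Ioo 0 b) : γ τ ∈ spacetimeM f := (hγ.2.1 τ hτ).1

theorem tendsto_apply_zero (i : Fin 4) : Tendsto (fun τ => γ τ i) (𝓝[>] 0) (𝓝 0) :=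
  ((continuous_apply i).tendsto 0).comp hγ.2.2

theorem tendsto_radius : Tendsto (fun τ => radius (γ τ)) (𝓝[>] 0) (𝓝 0) := by
  simpa [radius, Function.comp_def] using (continuous_radius.tendsto 0).comp hγ.2.2

theorem hasDerivAt (hf : IsProfile f) (hτ : τ ∈ Ioo 0 b) :
    HasDerivAt γ ((Real.exp (-Φ (zeta f (γ τ))) * (minkowskiLength (flowField f (γ τ)))⁻¹) •
      flowField f (γ τ)) τ := by
  have h := (hγ.2.1 τ hτ).2
  rwa [hf.fluidU_eq_unitField] at h

theorem hasDerivAt_time (hf : IsProfile f) (hτ : τ ∈ Ioo 0 b) : HasDerivAt (fun τ => γ τ 0)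
    (Real.exp (-Φ (zeta f (γ τ))) * (minkowskiLength (flowField f (γ τ)))⁻¹ * γ τ 0) τ :=
  hasDerivAt_pi.1 (hγ.hasDerivAt hf hτ) 0

theorem hasDerivAt_radius (hf : IsProfile f) (hτ : τ ∈ Ioo 0 b) (hr : 0 < radius (γ τ)) :
    HasDerivAt (fun τ => radius (γ τ)) (Real.exp (-Φ (zeta f (γ τ))) *
      (minkowskiLength (flowField f (γ τ)))⁻¹ * radialPart f (radius (γ τ))) τ := by
  refine ((hasPartials_radius hr).comp_curve (hγ.hasDerivAt hf hτ)).congr_deriv ?_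
  change _ ⬝ᵥ _ = _
  rw [smul_dotProduct, dotProduct_smul, spatialPart_dotProduct_flowField,
    ← hf.radialFactor_mul_self, smul_eq_mul, smul_eq_mul]
  field_simp

end IsComovingObserver

namespace IsProfile

variable {f : ℝ → ℝ} (hf : IsProfile f)
include hf

theorem hasDerivAt_sq_abs : HasDerivAt (fun r => f |r| ^ 2) 0 0 := by
  have hright : HasDerivWithinAt f (halfDeriv f 0) (Ici 0) 0 :=
    hasDerivWithinAt_halfDeriv (hf.contDiffOn.differentiableOn (by simp)) le_rfl
  have habs : Tendsto (fun s : ℝ => |s|) (𝓝 0) (𝓝[≥] 0) :=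
    tendsto_nhdsWithin_iff.2 ⟨by simpa using continuous_abs.tendsto (0 : ℝ),
      Eventually.of_forall abs_nonneg⟩
  have hO : (fun s : ℝ => f |s|) =O[𝓝 0] fun s => s := by
    have h := hright.differentiableWithinAt.isBigO_sub.comp_tendsto habs
    exact isBigO_abs_right.1 (by simpa [Function.comp_def, hf.apply_zero] using h)
  have ho : (fun s : ℝ => f |s|) =o[𝓝 0] fun _ => (1 : ℝ) := by
    rw [isLittleO_one_iff]
    simpa [Function.comp_def, hf.apply_zero] using hright.continuousWithinAt.tendsto.comp habs
  rw [hasDerivAt_iff_isLittleO]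
  simpa [hf.apply_zero, sq] using ho.mul_isBigO hO

theorem hasPartials_sq_radius (p : R4) : HasPartials (fun q => f (radius q) ^ 2)
    ((2 * radialFactor f (radius p) * halfDeriv f (radius p) ^ 2) • spatialPart p) p := by
  rcases (radius_nonneg p).eq_or_lt with h | h
  · rw [spatialPart_eq_zero_iff.2 h.symm, smul_zero]
    simpa [abs_of_nonneg (radius_nonneg _)] using
      hasPartials_comp_radius_of_radius_eq_zero hf.hasDerivAt_sq_abs h.symm
  · convert! HasPartials.scomp ((hf.hasDerivAt h).pow 2) (hasPartials_radius h) using 1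
    have hd := hf.halfDeriv_pos h.le
    rw [smul_smul, radialFactor, if_neg h.ne', radialPart]
    congr 1
    field_simp
    simp

theorem one_lt_trajectoryParam {p : R4} (hp : p ∈ spacetimeM f) : 1 < trajectoryParam f p := by
  rw [trajectoryParam]
  split_ifs with h
  · exact WithTop.coe_lt_top 1
  · exact WithTop.coe_lt_coe.2 <|
      (one_lt_div (hf.pos ((radius_nonneg p).lt_of_ne' h))).2 hp

theorem trajectoryParam_eq_of_div_eq {p q : R4} (hp : p ∈ spacetimeM f) (hq : q ∈ spacetimeM f)
    (h : f (radius p) / p 0 = f (radius q) / q 0) : trajectoryParam f p = trajectoryParam f q := by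
  have hzero : ∀ {p : R4}, p ∈ spacetimeM f → (radius p = 0 ↔ f (radius p) / p 0 = 0) :=
    fun {p} hp => by
      rw [div_eq_zero_iff, or_iff_left (hf.time_pos hp).ne']
      exact ⟨fun h => h ▸ hf.apply_zero, fun h => not_lt.1 (fun hr => (hf.pos hr).ne' h)
        |>.antisymm (radius_nonneg p)⟩
  rw [trajectoryParam, trajectoryParam, ← inv_div, h, inv_div]
  exact if_congr ((hzero hp).trans (h ▸ (hzero hq).symm)) rfl rfl

variable {Φ : ℝ → ℝ} {b : ℝ} {γ : ℝ → R4}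

theorem followsTrajectory_iff (hM : ∀ τ ∈ Ioo 0 b, γ τ ∈ spacetimeM f) {μ : WithTop ℝ} :
    FollowsTrajectory f b γ μ ↔ ∀ τ ∈ Ioo 0 b, trajectoryParam f (γ τ) = μ := by
  induction μ with
  | top => exact forall₂_congr fun τ _ => by simp [trajectoryParam]
  | coe μ =>
    refine forall₂_congr fun τ hτ => ?_
    rcases (radius_nonneg (γ τ)).eq_or_lt with h | h
    · simp [trajectoryParam, ← h, hf.apply_zero, (hf.time_pos (hM τ hτ)).ne']
    · rw [trajectoryParam, if_neg h.ne', WithTop.coe_inj, div_eq_iff (hf.pos h).ne']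

variable (hγ : IsComovingObserver f Φ b γ)
include hγ

theorem hasDerivAt_sq_radius {τ : ℝ} (hτ : τ ∈ Ioo 0 b) :
    HasDerivAt (fun τ => f (radius (γ τ)) ^ 2) (2 * (Real.exp (-Φ (zeta f (γ τ))) *
      (minkowskiLength (flowField f (γ τ)))⁻¹) * f (radius (γ τ)) ^ 2) τ := by
  refine ((hf.hasPartials_sq_radius (γ τ)).comp_curve (hγ.hasDerivAt hf hτ)).congr_deriv ?_
  have hk : f (radius (γ τ)) =
      radialFactor f (radius (γ τ)) * radius (γ τ) * halfDeriv f (radius (γ τ)) := by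
    rw [hf.radialFactor_mul_self, radialPart,
      div_mul_cancel₀ _ (hf.halfDeriv_pos (radius_nonneg _)).ne']
  change _ ⬝ᵥ _ = _
  rw [smul_dotProduct, dotProduct_smul, spatialPart_dotProduct_flowField, hk, smul_eq_mul,
    smul_eq_mul]
  ring

theorem hasDerivAt_sq_div_sq {τ : ℝ} (hτ : τ ∈ Ioo 0 b) :
    HasDerivAt (fun τ => (f (radius (γ τ)) / γ τ 0) ^ 2) 0 τ := by
  have ht := (hf.time_pos (hγ.mem hτ)).ne'
  simp only [div_pow]
  refine ((hf.hasDerivAt_sq_radius hγ hτ).div ((hγ.hasDerivAt_time hf hτ).pow 2)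
    (pow_ne_zero 2 ht)).congr_deriv ?_
  -- Differentiation along `u` multiplies both `t²` and `f(r)²` by `2 e^{-Φ} / |V|`.
  rw [div_eq_zero_iff]
  left
  simp only [Pi.pow_apply]
  ring

theorem trajectoryParam_observer_eq {τ τ' : ℝ} (hτ : τ ∈ Ioo 0 b) (hτ' : τ' ∈ Ioo 0 b) :
    trajectoryParam f (γ τ) = trajectoryParam f (γ τ') := by
  have hslope := isOpen_Ioo.is_const_of_deriv_eq_zero isPreconnected_Ioo
    (fun τ hτ => (hf.hasDerivAt_sq_div_sq hγ hτ).differentiableAt.differentiableWithinAt)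
    (fun τ hτ => (hf.hasDerivAt_sq_div_sq hγ hτ).deriv) hτ hτ'
  have hnonneg : ∀ τ ∈ Ioo 0 b, 0 ≤ f (radius (γ τ)) / γ τ 0 := fun τ hτ =>
    div_nonneg (hf.nonneg (radius_nonneg _)) (hf.time_pos (hγ.mem hτ)).le
  exact hf.trajectoryParam_eq_of_div_eq (hγ.mem hτ) (hγ.mem hτ')
    ((pow_left_inj₀ (hnonneg τ hτ) (hnonneg τ' hτ') two_ne_zero).1 hslope)

theorem existsUnique_trajectory : ∃! μ : WithTop ℝ, 1 < μ ∧ FollowsTrajectory f b γ μ := by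
  have hmid : b / 2 ∈ Ioo 0 b := ⟨half_pos hγ.1, half_lt_self hγ.1⟩
  simp only [hf.followsTrajectory_iff fun _ => hγ.mem]
  exact ⟨trajectoryParam f (γ (b / 2)), ⟨hf.one_lt_trajectoryParam (hγ.mem hmid),
    fun τ hτ => hf.trajectoryParam_observer_eq hγ hτ hmid⟩, fun μ hμ => (hμ.2 _ hmid).symm⟩

end IsProfile

/-! ### Scale factors -/

/-- `H` is the expansion rate `a' / a` on `(0, b)` of a universe emerging from a big bang at `0`,
with initial acceleration `ℓ`: it has a primitive `log a` tending to `-∞`, and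
`3 a'' / a = 3 (H' + H²)` tends to `ℓ`. -/
structure IsBigBangRate (b : ℝ) (H : ℝ → ℝ) (ℓ : ℝ) : Prop where
  pos : 0 < b
  exists_primitive : ∃ α : ℝ → ℝ, (∀ τ ∈ Ioo 0 b, HasDerivAt α (H τ) τ) ∧
    Tendsto α (𝓝[>] 0) atBot
  differentiableAt : ∀ τ ∈ Ioo 0 b, DifferentiableAt ℝ H τ
  tendsto : Tendsto (fun τ => 3 * (deriv H τ + H τ ^ 2)) (𝓝[>] 0) (𝓝 ℓ)

namespace IsBigBangRate

variable {b ℓ : ℝ} {H : ℝ → ℝ} (h : IsBigBangRate b H ℓ)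
include h

theorem exists_scaleFactor :
    ∃ a : ℝ → ℝ, ∀ τ ∈ Ioo 0 b, 0 < a τ ∧ DifferentiableAt ℝ a τ ∧ deriv a τ / a τ = H τ := by
  obtain ⟨α, hα, -⟩ := h.exists_primitive
  refine ⟨fun τ => Real.exp (α τ), fun τ hτ => ⟨Real.exp_pos _, (hα τ hτ).exp.differentiableAt, ?_⟩⟩
  rw [(hα τ hτ).exp.deriv, mul_div_cancel_left₀ _ (Real.exp_pos _).ne']

variable {a : ℝ → ℝ}
  (ha : ∀ τ ∈ Ioo 0 b, 0 < a τ ∧ DifferentiableAt ℝ a τ ∧ deriv a τ / a τ = H τ)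
include ha

theorem tendsto_scaleFactor : Tendsto a (𝓝[>] 0) (𝓝 0) := by
  obtain ⟨α, hα, hbot⟩ := h.exists_primitive
  have hderiv : ∀ τ ∈ Ioo 0 b, HasDerivAt (fun τ => a τ * Real.exp (-α τ)) 0 τ := by
    intro τ hτ
    obtain ⟨hpos, hdiff, hH⟩ := ha τ hτ
    refine (hdiff.hasDerivAt.mul (hα τ hτ).neg.exp).congr_deriv ?_
    rw [(div_eq_iff hpos.ne').1 hH, Pi.neg_apply]
    ring
  obtain ⟨C, hC⟩ := isOpen_Ioo.exists_is_const_of_deriv_eq_zero isPreconnected_Ioo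
    (fun τ hτ => (hderiv τ hτ).differentiableAt.differentiableWithinAt)
    (fun τ hτ => (hderiv τ hτ).deriv)
  have hlim := (Real.tendsto_exp_atBot.comp hbot).const_mul C
  rw [mul_zero] at hlim
  refine hlim.congr' ?_
  filter_upwards [Ioo_mem_nhdsGT h.pos] with τ hτ
  rw [← hC τ hτ, Function.comp_apply, mul_assoc, ← Real.exp_add, neg_add_cancel, Real.exp_zero,
    mul_one]

theorem hasDerivAt_deriv_scaleFactor {τ : ℝ} (hτ : τ ∈ Ioo 0 b) :
    HasDerivAt (deriv a) ((deriv H τ + H τ ^ 2) * a τ) τ := by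
  have hderiv : ∀ τ ∈ Ioo 0 b, deriv a τ = H τ * a τ := fun τ hτ =>
    (div_eq_iff (ha τ hτ).1.ne').1 (ha τ hτ).2.2
  have hmul := (h.differentiableAt τ hτ).hasDerivAt.mul (ha τ hτ).2.1.hasDerivAt
  rw [hderiv τ hτ] at hmul
  refine (hmul.congr_of_eventuallyEq ?_).congr_deriv (by ring)
  filter_upwards [isOpen_Ioo.mem_nhds hτ] with s hs using hderiv s hs

theorem tendsto_acceleration :
    Tendsto (fun τ => 3 * deriv (deriv a) τ / a τ) (𝓝[>] 0) (𝓝 ℓ) := by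
  refine h.tendsto.congr' ?_
  filter_upwards [Ioo_mem_nhdsGT h.pos] with τ hτ
  rw [(h.hasDerivAt_deriv_scaleFactor ha hτ).deriv, ← mul_assoc,
    mul_div_cancel_right₀ _ (ha τ hτ).1.ne']

theorem eventually_acceleration_pos (hℓ : 0 < ℓ) : ∀ᶠ τ in 𝓝[>] 0, 0 < deriv (deriv a) τ := by
  filter_upwards [(h.tendsto_acceleration ha).eventually (lt_mem_nhds hℓ),
    Ioo_mem_nhdsGT h.pos] with τ hquot hτ
  rw [div_pos_iff_of_pos_right (ha τ hτ).1] at hquot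
  linarith

theorem eventually_acceleration_neg (hℓ : ℓ < 0) : ∀ᶠ τ in 𝓝[>] 0, deriv (deriv a) τ < 0 := by
  filter_upwards [(h.tendsto_acceleration ha).eventually (gt_mem_nhds hℓ),
    Ioo_mem_nhdsGT h.pos] with τ hquot hτ
  rw [div_lt_iff₀ (ha τ hτ).1, zero_mul] at hquot
  linarith

end IsBigBangRate

/-! ### Expansions to second order at the origin -/

/-- `A` is twice differentiable on `(0, ∞)`, with derivative `A'`, and
`A r = A₀ + c r² / 2 + o(r²)` as `r → 0`, in the strong sense that `A → A₀`, `A' → 0` and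
`A'' → c`. -/
structure HasQuadraticExpansion (A A' : ℝ → ℝ) (A₀ c : ℝ) : Prop where
  hasDerivAt : ∀ r, 0 < r → HasDerivAt A (A' r) r
  tendsto : Tendsto A (𝓝[>] 0) (𝓝 A₀)
  tendsto_deriv : Tendsto A' (𝓝[>] 0) (𝓝 0)
  exists_deriv : ∃ A'' : ℝ → ℝ, (∀ r, 0 < r → HasDerivAt A' (A'' r) r) ∧
    Tendsto A'' (𝓝[>] 0) (𝓝 c)

namespace HasQuadraticExpansion

variable {A A' B B' : ℝ → ℝ} {A₀ B₀ c d : ℝ}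

theorem add (hA : HasQuadraticExpansion A A' A₀ c) (hB : HasQuadraticExpansion B B' B₀ d) :
    HasQuadraticExpansion (fun r => A r + B r) (fun r => A' r + B' r) (A₀ + B₀) (c + d) := by
  obtain ⟨A'', hA'', hc⟩ := hA.exists_deriv
  obtain ⟨B'', hB'', hd⟩ := hB.exists_deriv
  exact ⟨fun r hr => (hA.hasDerivAt r hr).add (hB.hasDerivAt r hr), hA.tendsto.add hB.tendsto,
    by simpa using hA.tendsto_deriv.add hB.tendsto_deriv, fun r => A'' r + B'' r,
    fun r hr => (hA'' r hr).add (hB'' r hr), hc.add hd⟩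

theorem const_mul (k : ℝ) (hA : HasQuadraticExpansion A A' A₀ c) :
    HasQuadraticExpansion (fun r => k * A r) (fun r => k * A' r) (k * A₀) (k * c) := by
  obtain ⟨A'', hA'', hc⟩ := hA.exists_deriv
  exact ⟨fun r hr => (hA.hasDerivAt r hr).const_mul k, hA.tendsto.const_mul k,
    by simpa using hA.tendsto_deriv.const_mul k, fun r => k * A'' r,
    fun r hr => (hA'' r hr).const_mul k, hc.const_mul k⟩

theorem tendsto_deriv_div_id (hA : HasQuadraticExpansion A A' A₀ c) :
    Tendsto (fun r => A' r / r) (𝓝[>] 0) (𝓝 c) := by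
  obtain ⟨A'', hA'', hc⟩ := hA.exists_deriv
  simpa using tendsto_div_pow_succ_nhdsGT_zero 0 hA'' hA.tendsto_deriv (by simpa using hc)

theorem comp {φ : ℝ → ℝ} (hA : HasQuadraticExpansion A A' A₀ c) (hφ₀ : ContDiffAt ℝ 2 φ A₀)
    (hφ : ∀ r, 0 < r → ContDiffAt ℝ 2 φ (A r)) :
    HasQuadraticExpansion (fun r => φ (A r)) (fun r => deriv φ (A r) * A' r) (φ A₀)
      (deriv φ A₀ * c) := by
  obtain ⟨A'', hA'', hc⟩ := hA.exists_deriv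
  have hcont : Tendsto (fun r => deriv φ (A r)) (𝓝[>] 0) (𝓝 (deriv φ A₀)) :=
    (hφ₀.derivWithin (m := 1) (by norm_num)).continuousAt.tendsto.comp hA.tendsto
  have hcont₂ : Tendsto (fun r => deriv (deriv φ) (A r)) (𝓝[>] 0) (𝓝 (deriv (deriv φ) A₀)) :=
    ((hφ₀.derivWithin (m := 1) (by norm_num)).derivWithin (m := 0)
      (by norm_num)).continuousAt.tendsto.comp hA.tendsto
  refine ⟨fun r hr => ?_, hφ₀.continuousAt.tendsto.comp hA.tendsto,
    by simpa using hcont.mul hA.tendsto_deriv,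
    fun r => deriv (deriv φ) (A r) * A' r * A' r + deriv φ (A r) * A'' r, fun r hr => ?_, ?_⟩
  · exact ((hφ r hr).differentiableAt (by norm_num)).hasDerivAt.comp r (hA.hasDerivAt r hr)
  · exact ((((hφ r hr).derivWithin (m := 1) (by norm_num)).differentiableAt
      (by norm_num)).hasDerivAt.comp r (hA.hasDerivAt r hr)).mul (hA'' r hr)
  · simpa using ((hcont₂.mul hA.tendsto_deriv).mul hA.tendsto_deriv).add (hcont.mul hc)

theorem continuousOn (hA : HasQuadraticExpansion A A' A₀ c) (h0 : A 0 = A₀) :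
    ContinuousOn A (Ici 0) := by
  intro r hr
  rcases (mem_Ici.1 hr).eq_or_lt with h | h
  · rw [← h, ← continuousWithinAt_sdiff_self, Ici_sdiff_left, ContinuousWithinAt, h0]
    exact hA.tendsto
  · exact (hA.hasDerivAt r h).continuousAt.continuousWithinAt

theorem tendsto_exp_neg_sq_mul {A'' : ℝ → ℝ} (hA : HasQuadraticExpansion A A' A₀ c)
    (hB : HasQuadraticExpansion B B' B₀ d) (hA'' : Tendsto A'' (𝓝[>] 0) (𝓝 c)) :
    Tendsto (fun r => Real.exp (-B r) ^ 2 *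
      (A'' r + 2 * (A' r / r) + A' r ^ 2 - B' r / r - B' r * A' r)) (𝓝[>] 0)
      (𝓝 (Real.exp (-2 * B₀) * (3 * c - d))) := by
  have hexp : Tendsto (fun r => Real.exp (-B r) ^ 2) (𝓝[>] 0) (𝓝 (Real.exp (-2 * B₀))) := by
    convert! ((Real.continuous_exp.tendsto _).comp hB.tendsto.neg).pow 2 using 2
    rw [← Real.exp_nat_mul]
    ring_nf
  convert! hexp.mul ((((hA''.add (hA.tendsto_deriv_div_id.const_mul 2)).add
    (hA.tendsto_deriv.pow 2)).sub hB.tendsto_deriv_div_id).sub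
      (hB.tendsto_deriv.mul hA.tendsto_deriv)) using 2
  ring

end HasQuadraticExpansion

/- With `α = log s + M(s)` as primitive of `H`, the poles `±1 / s²` cancel in
`e^{2N} (H' + H²) = M'' + 2 M' / s + M'² - N' / s - N' M'`, which tends to `c + 2 c - d`. -/
theorem IsBigBangRate.of_hasQuadraticExpansion {b M₀ N₀ c d : ℝ} {H s M M' N N' : ℝ → ℝ}
    (hM : HasQuadraticExpansion M M' M₀ c) (hN : HasQuadraticExpansion N N' N₀ d) (hb : 0 < b)
    (hs_pos : ∀ τ ∈ Ioo 0 b, 0 < s τ) (hs_zero : Tendsto s (𝓝[>] 0) (𝓝 0))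
    (hs : ∀ τ ∈ Ioo 0 b, HasDerivAt s (Real.exp (-N (s τ))) τ)
    (hH : ∀ τ ∈ Ioo 0 b, H τ = Real.exp (-N (s τ)) * (1 / s τ + M' (s τ))) :
    IsBigBangRate b H (3 * Real.exp (-2 * N₀) * (3 * c - d)) := by
  obtain ⟨M'', hM'', hc⟩ := hM.exists_deriv
  have hs_lim : Tendsto s (𝓝[>] 0) (𝓝[>] 0) := tendsto_nhdsWithin_iff.2 ⟨hs_zero, by
    filter_upwards [Ioo_mem_nhdsGT hb] with τ hτ using hs_pos τ hτ⟩
  have hHderiv : ∀ τ ∈ Ioo 0 b, HasDerivAt H (Real.exp (-N (s τ)) ^ 2 *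
      (M'' (s τ) - (s τ ^ 2)⁻¹ - N' (s τ) * (1 / s τ + M' (s τ)))) τ := by
    intro τ hτ
    have hr := hs_pos τ hτ
    have hρ : HasDerivAt (fun r => Real.exp (-N r) * (1 / r + M' r)) _ (s τ) :=
      (hN.hasDerivAt _ hr).neg.exp.mul (((hasDerivAt_inv hr.ne').congr_of_eventuallyEq
        (Eventually.of_forall fun r => one_div r)).add (hM'' _ hr))
    refine ((hρ.comp τ (hs τ hτ)).congr_of_eventuallyEq ?_).congr_deriv ?_
    · filter_upwards [isOpen_Ioo.mem_nhds hτ] with τ hτ using hH τ hτ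
    · simp only [Pi.neg_apply]
      ring
  refine ⟨hb, ⟨fun τ => Real.log (s τ) + M (s τ), fun τ hτ => ?_, ?_⟩,
    fun τ hτ => (hHderiv τ hτ).differentiableAt, ?_⟩
  · refine (((hs τ hτ).log (hs_pos τ hτ).ne').add
      ((hM.hasDerivAt _ (hs_pos τ hτ)).comp τ (hs τ hτ))).congr_deriv ?_
    rw [hH τ hτ]
    ring
  · exact (Real.tendsto_log_nhdsGT_zero.comp hs_lim).atBot_add (hM.tendsto.comp hs_lim)
  · have hlim := (hM.tendsto_exp_neg_sq_mul hN hc).const_mul 3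
    rw [← mul_assoc] at hlim
    refine (hlim.comp hs_lim).congr' ?_
    filter_upwards [Ioo_mem_nhdsGT hb] with τ hτ
    rw [(hHderiv τ hτ).deriv, hH τ hτ, Function.comp_apply]
    ring

/-! ### The expansion rate along a trajectory -/

/-- The value of `ζ` on the trajectory `t = μ f(r)`. -/
def trajectoryZeta (f : ℝ → ℝ) (μ r : ℝ) : ℝ :=
  (μ * f r) ^ 2 / 2 - ∫ s in (0 : ℝ)..r, f s / halfDeriv f s

/-- The quotient `|V|² / h²` on the trajectory `t = μ f(r)`. -/
def speedSq (f : ℝ → ℝ) (μ r : ℝ) : ℝ := μ ^ 2 * halfDeriv f r ^ 2 - 1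

/-- The logarithm of `dτ / dr = e^Φ |V| / h` on the trajectory `t = μ f(r)`. -/
def logTimeRate (f Φ : ℝ → ℝ) (μ r : ℝ) : ℝ :=
  Φ (trajectoryZeta f μ r) + 1 / 2 * Real.log (speedSq f μ r)

theorem zeta_eq_trajectoryZeta {f : ℝ → ℝ} {μ : ℝ} {p : R4} (hp : p 0 = μ * f (radius p)) :
    zeta f p = trajectoryZeta f μ (radius p) := by
  rw [zeta, trajectoryZeta, hp]

theorem zeta_of_radius_eq_zero (f : ℝ → ℝ) {p : R4} (hp : radius p = 0) :
    zeta f p = p 0 ^ 2 / 2 := by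
  rw [zeta, hp, intervalIntegral.integral_same, sub_zero]

theorem hasQuadraticExpansion_half_sq :
    HasQuadraticExpansion (fun r => r ^ 2 / 2) (fun r => r) 0 1 where
  hasDerivAt r _ := ((hasDerivAt_pow 2 r).div_const 2).congr_deriv (by simp)
  tendsto := by simpa using (tendsto_id_nhdsGT_zero.pow 2).div_const 2
  tendsto_deriv := tendsto_id_nhdsGT_zero
  exists_deriv := ⟨fun _ => 1, fun r _ => hasDerivAt_id r, tendsto_const_nhds⟩

namespace IsProfile

variable {f : ℝ → ℝ} (hf : IsProfile f)
include hf

theorem hasQuadraticExpansion_div_id : HasQuadraticExpansion (fun r => f r / r)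
    (fun r => (halfDeriv f r * r - f r) / r ^ 2) 1 (thirdDerivZero f / 3) := by
  refine ⟨fun r hr => ?_, hf.tendsto_div_id, ?_, fun r => halfDeriv (halfDeriv f) r / r -
    2 * ((halfDeriv f r * r - f r) / r ^ 3), fun r hr => ?_, ?_⟩
  · exact ((hf.hasDerivAt hr).div (hasDerivAt_id r) hr.ne').congr_deriv (by simp)
  · have h := hf.tendsto_halfDeriv_mul_sub_div_pow_three.mul tendsto_id_nhdsGT_zero
    rw [mul_zero] at h
    refine h.congr' ?_
    filter_upwards [self_mem_nhdsWithin] with r (hr : 0 < r)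
    field_simp
  · refine ((((hf.hasDerivAt_halfDeriv hr).mul (hasDerivAt_id r)).sub (hf.hasDerivAt hr)).div
      (hasDerivAt_pow 2 r) (by positivity)).congr_deriv ?_
    simp only [id, Pi.mul_apply, Pi.sub_apply]
    field_simp
    push_cast
    ring
  · convert hf.tendsto_halfDeriv_halfDeriv_div.sub
      (hf.tendsto_halfDeriv_mul_sub_div_pow_three.const_mul 2) using 2
    ring

theorem hasDerivAt_trajectoryZeta (μ : ℝ) {r : ℝ} (hr : 0 < r) :
    HasDerivAt (trajectoryZeta f μ) (radialPart f r * speedSq f μ r) r := by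
  have hint : HasDerivAt (fun r => ∫ s in (0 : ℝ)..r, f s / halfDeriv f s) (radialPart f r) r := by
    refine (hf.hasDerivAt_integral_radialPart hr.le).congr_of_eventuallyEq ?_
    filter_upwards [Ioi_mem_nhds hr] with r hr using integral_div_halfDeriv_eq (le_of_lt hr)
  refine (((((hf.hasDerivAt hr).const_mul μ).pow 2).div_const 2).sub hint).congr_deriv ?_
  have hd := (hf.halfDeriv_pos hr.le).ne'
  simp only [radialPart, speedSq]
  field_simp
  simp only [Nat.cast_ofNat, Nat.reduceSub, pow_one]
  ring

theorem hasDerivAt_speedSq (μ : ℝ) {r : ℝ} (hr : 0 < r) : HasDerivAt (speedSq f μ)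
    (2 * μ ^ 2 * halfDeriv f r * halfDeriv (halfDeriv f) r) r := by
  refine ((((hf.hasDerivAt_halfDeriv hr).pow 2).const_mul (μ ^ 2)).sub_const 1).congr_deriv ?_
  simp only [Nat.cast_ofNat, Nat.reduceSub, pow_one]
  ring

theorem hasQuadraticExpansion_speedSq (μ : ℝ) : HasQuadraticExpansion (speedSq f μ)
    (fun r => 2 * μ ^ 2 * halfDeriv f r * halfDeriv (halfDeriv f) r) (μ ^ 2 - 1)
    (2 * μ ^ 2 * thirdDerivZero f) where
  hasDerivAt r hr := hf.hasDerivAt_speedSq μ hr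
  tendsto := by
    have h := ((hf.tendsto_halfDeriv.pow 2).const_mul (μ ^ 2)).sub_const 1
    rwa [one_pow, mul_one] at h
  tendsto_deriv := by
    simpa using (hf.tendsto_halfDeriv.const_mul (2 * μ ^ 2)).mul hf.tendsto_halfDeriv_halfDeriv
  exists_deriv := by
    refine ⟨_, fun r hr => ((hf.hasDerivAt_halfDeriv hr).const_mul (2 * μ ^ 2)).mul
      (hf.hasDerivAt_halfDeriv_halfDeriv hr), ?_⟩
    simpa using ((hf.tendsto_halfDeriv_halfDeriv.const_mul (2 * μ ^ 2)).mul
      hf.tendsto_halfDeriv_halfDeriv).add ((hf.tendsto_halfDeriv.const_mul (2 * μ ^ 2)).mul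
        hf.tendsto_thirdDeriv)

theorem tendsto_radialPart : Tendsto (radialPart f) (𝓝[>] 0) (𝓝 0) := by
  simpa only [hf.radialPart_zero] using
    tendsto_nhdsGT_zero_of_continuousOn hf.continuousOn_radialPart

theorem tendsto_radialPartDeriv : Tendsto (radialPartDeriv f) (𝓝[>] 0) (𝓝 1) := by
  have h := ((hf.tendsto_zero.mul hf.tendsto_halfDeriv_halfDeriv).div
    (hf.tendsto_halfDeriv.pow 2) (by norm_num)).const_sub 1
  norm_num at h
  exact h

theorem tendsto_trajectoryZeta (μ : ℝ) : Tendsto (trajectoryZeta f μ) (𝓝[>] 0) (𝓝 0) := by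
  have hint : Tendsto (fun r => ∫ s in (0 : ℝ)..r, radialPart f (max s 0)) (𝓝[>] 0) (𝓝 0) := by
    simpa using (hf.hasDerivAt_integral_radialPart le_rfl).continuousAt.tendsto.mono_left
      nhdsWithin_le_nhds
  have h := (((hf.tendsto_zero.const_mul μ).pow 2).div_const 2).sub hint
  norm_num at h
  refine h.congr' ?_
  filter_upwards [self_mem_nhdsWithin] with r (hr : 0 < r)
  rw [trajectoryZeta, integral_div_halfDeriv_eq hr.le]

theorem hasQuadraticExpansion_trajectoryZeta (μ : ℝ) :
    HasQuadraticExpansion (trajectoryZeta f μ) (fun r => radialPart f r * speedSq f μ r) 0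
      (μ ^ 2 - 1) where
  hasDerivAt r hr := hf.hasDerivAt_trajectoryZeta μ hr
  tendsto := hf.tendsto_trajectoryZeta μ
  tendsto_deriv := by
    simpa using hf.tendsto_radialPart.mul (hf.hasQuadraticExpansion_speedSq μ).tendsto
  exists_deriv := by
    refine ⟨_, fun r hr => (hf.hasDerivAt_radialPart hr).mul (hf.hasDerivAt_speedSq μ hr), ?_⟩
    simpa using (hf.tendsto_radialPartDeriv.mul (hf.hasQuadraticExpansion_speedSq μ).tendsto).add
      (hf.tendsto_radialPart.mul (hf.hasQuadraticExpansion_speedSq μ).tendsto_deriv)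

variable {Φ : ℝ → ℝ} {b : ℝ} {γ : ℝ → R4}

theorem minkowskiLength_flowField_of_radius_eq_zero {p : R4} (hp : p ∈ spacetimeM f)
    (hr : radius p = 0) : minkowskiLength (flowField f p) = p 0 := by
  refine (pow_left_inj₀ (hf.minkowskiLength_flowField_pos hp).le (hf.time_pos hp).le
    two_ne_zero).1 ?_
  rw [hf.minkowskiLength_flowField_sq hp, hr, hf.radialPart_zero]
  ring

theorem minkowskiLength_flowField_sq_of_trajectory {μ : ℝ} {p : R4} (hp : p ∈ spacetimeM f)
    (hpμ : p 0 = μ * f (radius p)) : minkowskiLength (flowField f p) ^ 2 =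
      radialPart f (radius p) ^ 2 * speedSq f μ (radius p) := by
  have hd := hf.halfDeriv_pos (radius_nonneg p)
  rw [hf.minkowskiLength_flowField_sq hp, hpμ, radialPart, speedSq]
  field_simp

theorem radius_observer_pos {μ : ℝ} (hγ : IsComovingObserver f Φ b γ)
    (hfol : ∀ τ ∈ Ioo 0 b, γ τ 0 = μ * f (radius (γ τ))) {τ : ℝ} (hτ : τ ∈ Ioo 0 b) :
    0 < radius (γ τ) := by
  refine (radius_nonneg _).lt_of_ne' fun h => (hf.time_pos (hγ.mem hτ)).ne' ?_
  rw [hfol τ hτ, h, hf.apply_zero, mul_zero]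

section Ray

variable {μ : ℝ} (hμ : 1 < μ)
include hμ

theorem speedSq_pos {r : ℝ} (hr : 0 ≤ r) : 0 < speedSq f μ r := by
  rw [speedSq, ← mul_pow, sub_pos]
  exact one_lt_pow₀ (one_lt_mul_of_lt_of_le hμ (hf.one_le_halfDeriv r hr)) two_ne_zero

theorem hasQuadraticExpansion_log_speedSq :
    HasQuadraticExpansion (fun r => Real.log (speedSq f μ r))
      (fun r => deriv Real.log (speedSq f μ r) *
        (2 * μ ^ 2 * halfDeriv f r * halfDeriv (halfDeriv f) r))
      (Real.log (μ ^ 2 - 1)) (2 * μ ^ 2 * thirdDerivZero f / (μ ^ 2 - 1)) := by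
  have hμ' : 0 < μ ^ 2 - 1 := sub_pos.2 (one_lt_pow₀ hμ two_ne_zero)
  convert! (hf.hasQuadraticExpansion_speedSq μ).comp (Real.contDiffAt_log.2 hμ'.ne')
    fun r hr => Real.contDiffAt_log.2 (hf.speedSq_pos hμ hr.le).ne' using 1
  rw [Real.deriv_log]
  ring

theorem hasQuadraticExpansion_logTimeRate (hΦ : ContDiff ℝ 2 Φ) :
    HasQuadraticExpansion (logTimeRate f Φ μ)
      (fun r => deriv Φ (trajectoryZeta f μ r) * (radialPart f r * speedSq f μ r) +
        1 / 2 * (deriv Real.log (speedSq f μ r) *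
          (2 * μ ^ 2 * halfDeriv f r * halfDeriv (halfDeriv f) r)))
      (Φ 0 + 1 / 2 * Real.log (μ ^ 2 - 1))
      (deriv Φ 0 * (μ ^ 2 - 1) + 1 / 2 * (2 * μ ^ 2 * thirdDerivZero f / (μ ^ 2 - 1))) :=
  ((hf.hasQuadraticExpansion_trajectoryZeta μ).comp hΦ.contDiffAt fun _ _ => hΦ.contDiffAt).add
    ((hf.hasQuadraticExpansion_log_speedSq hμ).const_mul (1 / 2))

section Trajectory

variable {p : R4} (hp : p ∈ spacetimeM f) (hr : 0 < radius p) (hpμ : p 0 = μ * f (radius p))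
include hp hr hpμ

theorem exp_neg_logTimeRate : Real.exp (-logTimeRate f Φ μ (radius p)) =
    Real.exp (-Φ (zeta f p)) * (minkowskiLength (flowField f p))⁻¹ * radialPart f (radius p) := by
  have hS := hf.speedSq_pos hμ hr.le
  have hh : 0 < radialPart f (radius p) := div_pos (hf.pos hr) (hf.halfDeriv_pos hr.le)
  have hW : minkowskiLength (flowField f p) =
      radialPart f (radius p) * Real.exp (1 / 2 * Real.log (speedSq f μ (radius p))) := by
    refine (pow_left_inj₀ (hf.minkowskiLength_flowField_pos hp).le (by positivity)
      two_ne_zero).1 ?_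
    rw [hf.minkowskiLength_flowField_sq_of_trajectory hp hpμ, mul_pow, ← Real.exp_nat_mul,
      ← mul_assoc]
    norm_num [Real.exp_log hS]
  rw [logTimeRate, neg_add, Real.exp_add, hW, zeta_eq_trajectoryZeta hpμ, Real.exp_neg (1 / 2 * _)]
  field_simp

theorem meanCurv_of_trajectory (hΦ : Differentiable ℝ Φ) :
    meanCurv (spacetimeG f Φ) (fluidU f Φ) p = Real.exp (-logTimeRate f Φ μ (radius p)) *
      (1 / radius p + (deriv Φ (trajectoryZeta f μ (radius p)) *
          (radialPart f (radius p) * speedSq f μ (radius p)) +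
        1 / 3 * (halfDeriv f (radius p) / f (radius p) - 1 / radius p) -
        1 / 3 * (μ ^ 2 * halfDeriv f (radius p) * halfDeriv (halfDeriv f) (radius p) /
          speedSq f μ (radius p)))) := by
  have hS := hf.speedSq_pos hμ hr.le
  have hf0 := hf.pos hr
  have hd := hf.halfDeriv_pos hr.le
  have hW := hf.minkowskiLength_flowField_pos hp
  have hWsq := hf.minkowskiLength_flowField_sq_of_trajectory hp hpμ
  have hΦterm : 3 * deriv Φ (zeta f p) * minkowskiLength (flowField f p) =
      3 * deriv Φ (zeta f p) * (radialPart f (radius p) ^ 2 * speedSq f μ (radius p) /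
        minkowskiLength (flowField f p)) := by
    rw [← hWsq]
    field_simp
  rw [hf.meanCurv_eq hp hΦ, hΦterm, pow_succ _ 2, hWsq, hf.exp_neg_logTimeRate hμ hp hr hpμ,
    zeta_eq_trajectoryZeta hpμ, hpμ, radialFactor, if_neg hr.ne', radialPartDeriv]
  simp only [radialPart]
  have hS_eq : speedSq f μ (radius p) = μ ^ 2 * halfDeriv f (radius p) ^ 2 - 1 := rfl
  generalize speedSq f μ (radius p) = S at *
  field_simp
  rw [hS_eq]
  ring

end Trajectory

theorem isBigBangRate_of_ray (hγ : IsComovingObserver f Φ b γ)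
    (hfol : ∀ τ ∈ Ioo 0 b, γ τ 0 = μ * f (radius (γ τ))) (hΦ : ContDiff ℝ 2 Φ) :
    IsBigBangRate b (fun τ => meanCurv (spacetimeG f Φ) (fluidU f Φ) (γ τ))
      (accelLimit f Φ (μ : ℝ)) := by
  have hpos := fun τ hτ => hf.radius_observer_pos hγ hfol (τ := τ) hτ
  have hμ' : 0 < μ ^ 2 - 1 := sub_pos.2 (one_lt_pow₀ hμ two_ne_zero)
  have hM := (((hf.hasQuadraticExpansion_trajectoryZeta μ).comp hΦ.contDiffAt
    fun _ _ => hΦ.contDiffAt).add ((hf.hasQuadraticExpansion_div_id.comp (φ := Real.log)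
      (Real.contDiffAt_log.2 one_ne_zero) fun r hr =>
        Real.contDiffAt_log.2 (div_pos (hf.pos hr) hr).ne').const_mul (1 / 3))).add
    ((hf.hasQuadraticExpansion_log_speedSq hμ).const_mul (-1 / 6))
  convert IsBigBangRate.of_hasQuadraticExpansion hM
    (hf.hasQuadraticExpansion_logTimeRate hμ hΦ) hγ.1 hpos hγ.tendsto_radius
    (fun τ hτ => ?_) (fun τ hτ => ?_) using 1
  · have hexp : Real.exp (-2 * (Φ 0 + 1 / 2 * Real.log (μ ^ 2 - 1))) =
        Real.exp (-2 * Φ 0) / (μ ^ 2 - 1) := by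
      rw [show -2 * (Φ 0 + 1 / 2 * Real.log (μ ^ 2 - 1)) = -2 * Φ 0 - Real.log (μ ^ 2 - 1) by ring,
        Real.exp_sub, Real.exp_log hμ']
    simp only [accelLimit, hexp, Real.deriv_log]
    field_simp
    ring
  · rw [hf.exp_neg_logTimeRate hμ (hγ.mem hτ) (hpos τ hτ) (hfol τ hτ)]
    exact hγ.hasDerivAt_radius hf hτ (hpos τ hτ)
  · have hr := hpos τ hτ
    have hf0 := hf.pos hr
    have hS := hf.speedSq_pos hμ hr.le
    rw [hf.meanCurv_of_trajectory hμ (hγ.mem hτ) hr (hfol τ hτ) (hΦ.differentiable (by norm_num)),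
      Real.deriv_log, Real.deriv_log]
    field_simp
    ring

end Ray

theorem isBigBangRate_of_center (hγ : IsComovingObserver f Φ b γ)
    (hfol : ∀ τ ∈ Ioo 0 b, radius (γ τ) = 0) (hΦ : ContDiff ℝ 2 Φ) :
    IsBigBangRate b (fun τ => meanCurv (spacetimeG f Φ) (fluidU f Φ) (γ τ))
      (accelLimit f Φ ⊤) := by
  have hE : HasQuadraticExpansion (fun t => Φ (t ^ 2 / 2)) (fun t => deriv Φ (t ^ 2 / 2) * t) (Φ 0)
      (deriv Φ 0) := by
    simpa using hasQuadraticExpansion_half_sq.comp hΦ.contDiffAt fun _ _ => hΦ.contDiffAt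
  have hpos := fun τ (hτ : τ ∈ Ioo 0 b) => hf.time_pos (hγ.mem hτ)
  have hzeta := fun τ hτ => zeta_of_radius_eq_zero f (hfol τ hτ)
  have hW := fun τ hτ =>
    hf.minkowskiLength_flowField_of_radius_eq_zero (hγ.mem hτ) (hfol τ hτ)
  convert IsBigBangRate.of_hasQuadraticExpansion hE hE hγ.1 hpos (hγ.tendsto_apply_zero 0)
    (fun τ hτ => ?_) (fun τ hτ => ?_) using 1
  · simp only [accelLimit]
    ring
  · convert hγ.hasDerivAt_time hf hτ using 1
    rw [hzeta τ hτ, hW τ hτ, mul_assoc, inv_mul_cancel₀ (hpos τ hτ).ne', mul_one]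
  · have ht := hpos τ hτ
    rw [hf.meanCurv_eq (hγ.mem hτ) (hΦ.differentiable (by norm_num)), hzeta τ hτ, hW τ hτ,
      hfol τ hτ, hf.radialPart_zero, radialPartDeriv, hf.apply_zero, radialFactor, if_pos rfl]
    field_simp
    ring

theorem isBigBangRate (hγ : IsComovingObserver f Φ b γ) (hΦ : ContDiff ℝ 2 Φ) {μ : WithTop ℝ}
    (hμ : 1 < μ) (hfol : FollowsTrajectory f b γ μ) :
    IsBigBangRate b (fun τ => meanCurv (spacetimeG f Φ) (fluidU f Φ) (γ τ))
      (accelLimit f Φ μ) := by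
  induction μ with
  | top => exact hf.isBigBangRate_of_center hγ hfol hΦ
  | coe μ => exact hf.isBigBangRate_of_ray (WithTop.coe_lt_coe.1 hμ) hγ hfol hΦ

end IsProfile

/-! ### Existence of observers -/

theorem tendsto_atTop_and_atBot_of_le_deriv {θ k : ℝ → ℝ} (hθ : ∀ s, HasDerivAt θ (k s) s) {m : ℝ}
    (hm : 0 < m) (hmk : ∀ s, m ≤ k s) : Tendsto θ atTop atTop ∧ Tendsto θ atBot atBot := by
  have hmono : Monotone fun s => θ s - m * s := monotone_of_hasDerivAt_nonneg
    (fun s => (hθ s).sub ((hasDerivAt_id s).const_mul m)) fun s => by simpa using hmk s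
  constructor
  · refine tendsto_atTop_mono' _ ?_
      (tendsto_atTop_add_const_left _ (θ 0) (tendsto_id.const_mul_atTop hm))
    filter_upwards [eventually_ge_atTop 0] with s hs
    have := hmono hs
    simp only [id]
    linarith
  · refine tendsto_atBot_mono' _ ?_
      (tendsto_atBot_add_const_left _ (θ 0) (tendsto_id.const_mul_atBot hm))
    filter_upwards [eventually_le_atBot 0] with s hs
    have := hmono hs
    simp only [id]
    linarith

theorem exists_strictMono_hasDerivAt_inv {k : ℝ → ℝ} (hk : Continuous k) {m : ℝ} (hm : 0 < m)
    (hmk : ∀ s, m ≤ k s) : ∃ σ : ℝ → ℝ, StrictMono σ ∧ Function.Surjective σ ∧ σ 0 = 0 ∧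
      ∀ τ, HasDerivAt σ (k (σ τ))⁻¹ τ := by
  have hθ : ∀ s, HasDerivAt (fun s => ∫ x in (0 : ℝ)..s, k x) (k s) s := fun s =>
    (hk.integral_hasStrictDerivAt 0 s).hasDerivAt
  have hpos : ∀ s, 0 < k s := fun s => hm.trans_le (hmk s)
  obtain ⟨htop, hbot⟩ := tendsto_atTop_and_atBot_of_le_deriv hθ hm hmk
  let e : ℝ ≃o ℝ := (strictMono_of_hasDerivAt_pos hθ hpos).orderIsoOfSurjective _
    ((continuous_iff_continuousAt.2 fun s => (hθ s).continuousAt).surjective htop hbot)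
  refine ⟨e.symm, e.symm.strictMono, e.symm.surjective, ?_, fun τ => ?_⟩
  · exact e.symm_apply_eq.2 intervalIntegral.integral_same.symm
  · exact (hθ (e.symm τ)).of_local_left_inverse e.symm.continuous.continuousAt (hpos _).ne'
      (Eventually.of_forall e.apply_symm_apply)

theorem exists_reparametrization {k : ℝ → ℝ} (hk : ContinuousOn k (Ici 0))
    (hpos : ∀ s, 0 ≤ s → 0 < k s) {s₀ : ℝ} (hs₀ : 0 < s₀) :
    ∃ (b : ℝ) (σ : ℝ → ℝ), (∀ τ ∈ Ioo 0 b, 0 < σ τ ∧ HasDerivAt σ (k (σ τ))⁻¹ τ) ∧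
      Tendsto σ (𝓝[>] 0) (𝓝[>] 0) ∧ ∃ τ ∈ Ioo 0 b, σ τ = s₀ := by
  -- Only the values of `k` on `[0, s₀ + 1]` matter; freezing `k` outside makes it bounded below.
  have hS : 0 ≤ s₀ + 1 := by positivity
  obtain ⟨x, hx, hmin⟩ := isCompact_Icc.exists_isMinOn (nonempty_Icc.2 hS)
    (hk.mono Icc_subset_Ici_self)
  obtain ⟨σ, hmono, hsurj, h0, hσ⟩ := exists_strictMono_hasDerivAt_inv
    (continuous_IccExtend_iff (h := hS).2 (hk.mono Icc_subset_Ici_self).domRestrict) (hpos x hx.1)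
    fun s => hmin (projIcc 0 (s₀ + 1) hS s).2
  obtain ⟨b, hb⟩ := hsurj (s₀ + 1)
  obtain ⟨τ₀, hτ₀⟩ := hsurj s₀
  have hσpos : ∀ τ, 0 < τ → 0 < σ τ := fun τ hτ => h0 ▸ hmono hτ
  refine ⟨b, σ, fun τ hτ => ⟨hσpos τ hτ.1, ?_⟩, tendsto_nhdsWithin_iff.2 ⟨?_, ?_⟩, τ₀,
    ⟨?_, ?_⟩, hτ₀⟩
  · have hmem : σ τ ∈ Icc 0 (s₀ + 1) := ⟨(hσpos τ hτ.1).le, hb ▸ (hmono hτ.2).le⟩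
    convert hσ τ using 2
    exact (IccExtend_of_mem hS (domRestrict (Icc 0 (s₀ + 1)) k) hmem).symm
  · simpa only [h0] using (hσ 0).continuousAt.tendsto.mono_left nhdsWithin_le_nhds
  · filter_upwards [self_mem_nhdsWithin] with τ hτ using hσpos τ hτ
  · rwa [← hmono.lt_iff_lt, h0, hτ₀]
  · rw [← hmono.lt_iff_lt, hτ₀, hb]
    exact lt_add_one s₀

theorem exists_observer_of_curve {f Φ N : ℝ → ℝ} {c : ℝ → R4} (hN : ContinuousOn N (Ici 0))
    (hc : ∀ s, 0 < s → c s ∈ spacetimeM f ∧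
      HasDerivAt c (Real.exp (N s) • fluidU f Φ (c s)) s)
    (hc_zero : Tendsto c (𝓝[>] 0) (𝓝 0)) {s₀ : ℝ} (hs₀ : 0 < s₀) :
    ∃ (b : ℝ) (γ : ℝ → R4), IsComovingObserver f Φ b γ ∧ ∃ τ ∈ Ioo 0 b, γ τ = c s₀ := by
  obtain ⟨b, σ, hσ, hσ_zero, τ₀, hτ₀, rfl⟩ :=
    exists_reparametrization hN.rexp (fun s _ => Real.exp_pos (N s)) hs₀
  refine ⟨b, c ∘ σ, ⟨hτ₀.1.trans hτ₀.2, fun τ hτ => ?_, hc_zero.comp hσ_zero⟩, τ₀, hτ₀, rfl⟩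
  obtain ⟨hσpos, hσ'⟩ := hσ τ hτ
  obtain ⟨hmem, hc'⟩ := hc (σ τ) hσpos
  exact ⟨hmem, (hc'.scomp τ hσ').congr_deriv (inv_smul_smul₀ (Real.exp_pos _).ne' _)⟩

/-- The curve `t = μ f(r)` in the half plane spanned by the time axis and the point `p`, with
`μ` chosen such that the curve passes through `p`, parametrized by `r`. -/
def trajectoryThrough (f : ℝ → ℝ) (p : R4) (r : ℝ) : R4 :=
  ![p 0 / f (radius p) * f r, r * (p 1 / radius p), r * (p 2 / radius p), r * (p 3 / radius p)]

theorem radius_trajectoryThrough (f : ℝ → ℝ) {p : R4} (hp : 0 < radius p) {r : ℝ} (hr : 0 ≤ r) :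
    radius (trajectoryThrough f p r) = r := by
  refine (pow_left_inj₀ (radius_nonneg _) hr two_ne_zero).1 ?_
  rw [radius_sq]
  simp only [trajectoryThrough, Matrix.cons_val]
  rw [mul_pow, mul_pow, mul_pow, ← mul_add, ← mul_add, div_pow, div_pow, div_pow, ← add_div,
    ← add_div, ← radius_sq, div_self (by positivity), mul_one]

namespace IsProfile

variable {f : ℝ → ℝ} (hf : IsProfile f) {Φ : ℝ → ℝ} {p : R4}
include hf

theorem hasDerivAt_trajectoryThrough (hr : 0 < radius p) {s : ℝ} (hs : 0 < s) :
    HasDerivAt (trajectoryThrough f p)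
      ((radialPart f s)⁻¹ • flowField f (trajectoryThrough f p s)) s := by
  have hfs := (hf.pos hs).ne'
  have hd := (hf.halfDeriv_pos hs.le).ne'
  rw [flowField, radius_trajectoryThrough f hr hs.le, hasDerivAt_pi]
  intro i
  fin_cases i
  · refine ((hf.hasDerivAt hs).const_mul _).congr_deriv ?_
    simp only [trajectoryThrough, radialPart, Fin.zero_eta, Pi.smul_apply, Matrix.cons_val,
      smul_eq_mul]
    field_simp
  all_goals
    refine ((hasDerivAt_id s).mul_const _).congr_deriv ?_
    simp only [trajectoryThrough, radialPart, radialFactor, hs.ne', if_false, one_mul,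
      Fin.mk_one, Fin.reduceFinMk, Pi.smul_apply, Matrix.cons_val, smul_eq_mul]
    field_simp

variable (hp : p ∈ spacetimeM f)
include hp

theorem exists_observer_of_radius_eq_zero (hΦ : Continuous Φ) (hr : radius p = 0) :
    ∃ (b : ℝ) (γ : ℝ → R4), IsComovingObserver f Φ b γ ∧ ∃ τ ∈ Ioo 0 b, γ τ = p := by
  have hrad : ∀ s, radius (Pi.single 0 s) = 0 := fun s => by simp [radius]
  have hc : ∀ s, HasDerivAt (fun s => (Pi.single 0 s : R4)) (Pi.single 0 1) s := fun s =>
    hasDerivAt_single 0 s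
  have hp_eq : p = Pi.single 0 (p 0) := by
    funext i
    rcases eq_or_ne i 0 with rfl | hi
    · simp
    · rw [apply_eq_zero_of_radius_eq_zero hr hi, Pi.single_eq_of_ne hi]
  rw [hp_eq]
  refine exists_observer_of_curve (N := fun s => Φ (s ^ 2 / 2)) (c := fun s => Pi.single 0 s)
    (by fun_prop) (fun s hs => ?_) ?_ (hf.time_pos hp)
  · have hmem : (Pi.single 0 s : R4) ∈ spacetimeM f := by
      simpa [spacetimeM, hrad, hf.apply_zero] using hs
    refine ⟨hmem, (hc s).congr_deriv ?_⟩
    rw [hf.fluidU_eq_unitField, unitField, zeta_of_radius_eq_zero f (hrad s),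
      hf.minkowskiLength_flowField_of_radius_eq_zero hmem (hrad s), Pi.single_eq_same, smul_smul,
      ← mul_assoc, ← Real.exp_add, add_neg_cancel, Real.exp_zero, one_mul]
    funext i
    fin_cases i <;> simp [flowField, hs.ne']
  · simpa using (hc 0).continuousAt.tendsto.mono_left nhdsWithin_le_nhds

theorem exists_observer_of_radius_pos (hΦ : ContDiff ℝ 2 Φ) (hr : 0 < radius p) :
    ∃ (b : ℝ) (γ : ℝ → R4), IsComovingObserver f Φ b γ ∧ ∃ τ ∈ Ioo 0 b, γ τ = p := by
  have hμ : 1 < p 0 / f (radius p) := (one_lt_div (hf.pos hr)).2 hp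
  have hN : ContinuousOn (logTimeRate f Φ (p 0 / f (radius p))) (Ici 0) := by
    refine (hf.hasQuadraticExpansion_logTimeRate hμ hΦ).continuousOn ?_
    simp [logTimeRate, trajectoryZeta, speedSq, hf.apply_zero, hf.halfDeriv_zero]
  have hp_eq : trajectoryThrough f p (radius p) = p := by
    have := (hf.pos hr).ne'
    funext i
    fin_cases i <;> simp only [trajectoryThrough, Fin.zero_eta, Fin.mk_one, Fin.reduceFinMk,
      Matrix.cons_val] <;> field_simp
  rw [← hp_eq]
  refine exists_observer_of_curve hN (fun s hs => ?_) ?_ hr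
  · have hrad := radius_trajectoryThrough f hr hs.le
    have hmem : trajectoryThrough f p s ∈ spacetimeM f := by
      rw [spacetimeM, mem_ofPred, hrad]
      exact lt_mul_of_one_lt_left (hf.pos hs) hμ
    have hrate := hf.exp_neg_logTimeRate (Φ := Φ) hμ hmem (hrad.symm ▸ hs) (hrad.symm ▸ rfl)
    rw [hrad] at hrate
    refine ⟨hmem, (hf.hasDerivAt_trajectoryThrough hr hs).congr_deriv ?_⟩
    have hh : radialPart f s ≠ 0 := (div_pos (hf.pos hs) (hf.halfDeriv_pos hs.le)).ne'
    rw [hf.fluidU_eq_unitField, unitField, smul_smul, eq_div_of_mul_eq hh hrate.symm,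
      Real.exp_neg, ← mul_div_assoc, mul_inv_cancel₀ (Real.exp_pos _).ne', one_div]
  · refine tendsto_pi_nhds.2 fun i => ?_
    fin_cases i
    · simpa [trajectoryThrough] using hf.tendsto_zero.const_mul (p 0 / f (radius p))
    all_goals simpa [trajectoryThrough] using tendsto_id_nhdsGT_zero.mul_const (_ / radius p)

theorem exists_observer (hΦ : ContDiff ℝ 2 Φ) :
    ∃ (b : ℝ) (γ : ℝ → R4), IsComovingObserver f Φ b γ ∧ ∃ τ ∈ Ioo 0 b, γ τ = p := by
  rcases (radius_nonneg p).eq_or_lt with h | h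
  · exact hf.exists_observer_of_radius_eq_zero hp hΦ.continuous h.symm
  · exact hf.exists_observer_of_radius_pos hp hΦ h

end IsProfile

/-! ### The threshold -/

section Threshold

variable {f Φ : ℝ → ℝ}

theorem accelLimit_coe {μ : ℝ} (hμ : 1 < μ) : accelLimit f Φ (μ : WithTop ℝ) =
    Real.exp (-2 * Φ 0) / (μ ^ 2 - 1) ^ 2 *
      (6 * deriv Φ 0 * (μ ^ 2 - 1) ^ 2 - thirdDerivZero f * (5 * (μ ^ 2 - 1) + 6)) := by
  have hm : 0 < μ ^ 2 - 1 := sub_pos.2 (one_lt_pow₀ hμ two_ne_zero)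
  simp only [accelLimit]
  field_simp
  ring

theorem muCrit_eq_one (hP : 0 < deriv Φ 0) (hc : thirdDerivZero f = 0) : muCrit f Φ = 1 := by
  simp [muCrit, hc, hP.ne']

variable (hc : 0 ≤ thirdDerivZero f) (hP : 0 < deriv Φ 0)
include hc hP

theorem muCrit_sq_sub_one : muCrit f Φ ^ 2 - 1 = (5 * thirdDerivZero f +
    Real.sqrt (144 * deriv Φ 0 * thirdDerivZero f + 25 * thirdDerivZero f ^ 2)) /
      (12 * deriv Φ 0) := by
  rw [muCrit, Real.sq_sqrt (by positivity)]
  field_simp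
  ring

theorem muCrit_sq_sub_one_isRoot : 6 * deriv Φ 0 * (muCrit f Φ ^ 2 - 1) ^ 2 =
    thirdDerivZero f * (5 * (muCrit f Φ ^ 2 - 1) + 6) := by
  have hsq := Real.sq_sqrt (x := 144 * deriv Φ 0 * thirdDerivZero f + 25 * thirdDerivZero f ^ 2)
    (by positivity)
  rw [muCrit_sq_sub_one hc hP]
  generalize Real.sqrt _ = s at *
  field_simp
  linear_combination 6 * hsq

theorem five_mul_thirdDerivZero_le : 5 * thirdDerivZero f ≤
    6 * deriv Φ 0 * (muCrit f Φ ^ 2 - 1) := by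
  have hle : 5 * thirdDerivZero f ≤
      Real.sqrt (144 * deriv Φ 0 * thirdDerivZero f + 25 * thirdDerivZero f ^ 2) := by
    refine Real.le_sqrt_of_sq_le ?_
    rw [mul_pow]
    norm_num
    positivity
  rw [muCrit_sq_sub_one hc hP]
  generalize Real.sqrt _ = s at *
  field_simp
  linarith

theorem exists_accelLimit_coe_eq_mul {μ : ℝ} (hμ : 1 < μ) :
    ∃ κ, 0 < κ ∧ accelLimit f Φ (μ : WithTop ℝ) = κ * (μ ^ 2 - muCrit f Φ ^ 2) := by
  have hm : 0 < μ ^ 2 - 1 := sub_pos.2 (one_lt_pow₀ hμ two_ne_zero)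
  have hslope : 0 < 6 * deriv Φ 0 * (μ ^ 2 - 1 + (muCrit f Φ ^ 2 - 1)) - 5 * thirdDerivZero f := by
    linarith [five_mul_thirdDerivZero_le hc hP, mul_pos hP hm]
  refine ⟨_, mul_pos (div_pos (Real.exp_pos (-2 * Φ 0)) (pow_pos hm 2)) hslope, ?_⟩
  rw [accelLimit_coe hμ]
  linear_combination (Real.exp (-2 * Φ 0) / (μ ^ 2 - 1) ^ 2) * muCrit_sq_sub_one_isRoot hc hP

theorem accelLimit_pos {μ : WithTop ℝ} (hμ : 1 < μ) (h : (muCrit f Φ : WithTop ℝ) < μ) :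
    0 < accelLimit f Φ μ := by
  induction μ with
  | top =>
    simp only [accelLimit]
    positivity
  | coe μ =>
    obtain ⟨κ, hκ, hμκ⟩ := exists_accelLimit_coe_eq_mul hc hP (WithTop.coe_lt_coe.1 hμ)
    rw [hμκ]
    exact mul_pos hκ (sub_pos.2
      (pow_lt_pow_left₀ (WithTop.coe_lt_coe.1 h) (Real.sqrt_nonneg _) two_ne_zero))

theorem accelLimit_neg {μ : WithTop ℝ} (hμ : 1 < μ) (h : μ < (muCrit f Φ : WithTop ℝ)) :
    accelLimit f Φ μ < 0 := by
  induction μ with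
  | top => exact absurd h not_top_lt
  | coe μ =>
    have hμ' : 1 < μ := WithTop.coe_lt_coe.1 hμ
    obtain ⟨κ, hκ, hμκ⟩ := exists_accelLimit_coe_eq_mul hc hP hμ'
    rw [hμκ]
    exact mul_neg_of_pos_of_neg hκ (sub_neg.2
      (pow_lt_pow_left₀ (WithTop.coe_lt_coe.1 h) (by positivity) two_ne_zero))

end Threshold

theorem mainTheorem3_general {f Φ : ℝ → ℝ} (hf : IsProfile f) (hΦ : ContDiff ℝ 2 Φ) :
    (∀ ε > 0, ∀ δ > 0, ∀ᶠ p in 𝓝[spacetimeMEps f ε] (0 : R4), ∀ e : Fin 3 → R4,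
      IsRestFrame (spacetimeG f Φ) (fluidU f Φ) p e →
        shearSq (spacetimeG f Φ) (fluidU f Φ) p e < δ) ∧
    (∀ p ∈ spacetimeM f, ∃ (b : ℝ) (γ : ℝ → R4), IsComovingObserver f Φ b γ ∧
      ∃ τ ∈ Ioo 0 b, γ τ = p) ∧
    ∀ (b : ℝ) (γ : ℝ → R4), IsComovingObserver f Φ b γ →
      (∃! μ : WithTop ℝ, 1 < μ ∧ FollowsTrajectory f b γ μ) ∧
      (∃ a : ℝ → ℝ, IsScaleFactor f Φ b γ a) ∧
      ∀ a : ℝ → ℝ, IsScaleFactor f Φ b γ a →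
        Tendsto a (𝓝[>] 0) (𝓝 0) ∧
        (∀ τ ∈ Ioo 0 b, DifferentiableAt ℝ (deriv a) τ) ∧
        (∀ μ : WithTop ℝ, 1 < μ → FollowsTrajectory f b γ μ →
          Tendsto (fun τ => 3 * deriv (deriv a) τ / a τ) (𝓝[>] 0) (𝓝 (accelLimit f Φ μ))) ∧
        (0 < deriv Φ 0 →
          (∀ μ : WithTop ℝ, 1 < μ → FollowsTrajectory f b γ μ →
            ((muCrit f Φ : WithTop ℝ) < μ → ∀ᶠ τ in 𝓝[>] 0, 0 < deriv (deriv a) τ) ∧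
            (μ < (muCrit f Φ : WithTop ℝ) → ∀ᶠ τ in 𝓝[>] 0, deriv (deriv a) τ < 0)) ∧
          (thirdDerivZero f = 0 → ∀ᶠ τ in 𝓝[>] 0, 0 < deriv (deriv a) τ)) := by
  have hc := hf.thirdDerivZero_nonneg
  refine ⟨fun ε hε δ hδ => hf.eventually_shearSq_lt (hΦ.differentiable two_ne_zero) hε hδ,
    fun p hp => hf.exists_observer hp hΦ, fun b γ hγ => ?_⟩
  have hrate := fun μ (hμ : 1 < μ) => hf.isBigBangRate hγ hΦ hμ
  obtain ⟨μ₀, ⟨hμ₀, hfol₀⟩, -⟩ := hf.existsUnique_trajectory hγ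
  have hrate₀ := hrate μ₀ hμ₀ hfol₀
  refine ⟨hf.existsUnique_trajectory hγ, hrate₀.exists_scaleFactor, fun a ha =>
    ⟨hrate₀.tendsto_scaleFactor ha,
      fun τ hτ => (hrate₀.hasDerivAt_deriv_scaleFactor ha hτ).differentiableAt,
      fun μ hμ hfol => (hrate μ hμ hfol).tendsto_acceleration ha,
      fun hP => ⟨fun μ hμ hfol => ⟨fun h => ?_, fun h => ?_⟩, fun h => ?_⟩⟩⟩
  · exact (hrate μ hμ hfol).eventually_acceleration_pos ha (accelLimit_pos hc hP hμ h)
  · exact (hrate μ hμ hfol).eventually_acceleration_neg ha (accelLimit_neg hc hP hμ h)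
  · refine hrate₀.eventually_acceleration_pos ha (accelLimit_pos hc hP hμ₀ ?_)
    rwa [muCrit_eq_one hP h]

end

theorem mainTheorem3 (f Φ : ℝ → ℝ)
    (hf : ContDiffOn ℝ ∞ f (Ici 0))
    (hf_pos : ∀ r, 0 < r → 0 < f r)
    (hf_zero : (fun r => f r - r) =O[𝓝[≥] (0 : ℝ)] fun r => r ^ 3)
    (hf_deriv : ∀ r, 0 ≤ r → 1 ≤ halfDeriv f r)
    (hΦ : ContDiff ℝ ∞ Φ) :
    -- the shear vanishes at the origin, within every `M_ε`
    (∀ ε > 0, ∀ δ > 0, ∀ᶠ p in 𝓝[spacetimeMEps f ε] (0 : R4), ∀ e : Fin 3 → R4,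
      IsRestFrame (spacetimeG f Φ) (fluidU f Φ) p e →
        shearSq (spacetimeG f Φ) (fluidU f Φ) p e < δ) ∧
    -- a comoving observer passes through every point of `M`
    (∀ p ∈ spacetimeM f, ∃ (b : ℝ) (γ : ℝ → R4), IsComovingObserver f Φ b γ ∧
      ∃ τ ∈ Ioo 0 b, γ τ = p) ∧
    ∀ (b : ℝ) (γ : ℝ → R4), IsComovingObserver f Φ b γ →
      (∃! μ : WithTop ℝ, 1 < μ ∧ FollowsTrajectory f b γ μ) ∧
      (∃ a : ℝ → ℝ, IsScaleFactor f Φ b γ a) ∧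
      ∀ a : ℝ → ℝ, IsScaleFactor f Φ b γ a →
        Tendsto a (𝓝[>] 0) (𝓝 0) ∧
        (∀ τ ∈ Ioo 0 b, DifferentiableAt ℝ (deriv a) τ) ∧
        (∀ μ : WithTop ℝ, 1 < μ → FollowsTrajectory f b γ μ →
          Tendsto (fun τ => 3 * deriv (deriv a) τ / a τ) (𝓝[>] 0) (𝓝 (accelLimit f Φ μ))) ∧
        (0 < deriv Φ 0 →
          (∀ μ : WithTop ℝ, 1 < μ → FollowsTrajectory f b γ μ →
            ((muCrit f Φ : WithTop ℝ) < μ → ∀ᶠ τ in 𝓝[>] 0, 0 < deriv (deriv a) τ) ∧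
            (μ < (muCrit f Φ : WithTop ℝ) → ∀ᶠ τ in 𝓝[>] 0, deriv (deriv a) τ < 0)) ∧
          (thirdDerivZero f = 0 → ∀ᶠ τ in 𝓝[>] 0, 0 < deriv (deriv a) τ)) := by
  exact mainTheorem3_general
    ⟨hf.of_le (WithTop.coe_le_coe.2 le_top), hf_zero, hf_deriv⟩
    (hΦ.of_le (WithTop.coe_le_coe.2 le_top))
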